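/- Let $m\ge 1$ and $\mathbf Q=(Q_1,\dots,Q_{m-1})\in\mathbb C^{m-1}$. The deformed current Lie algebra $\mathfrak{gl}_m^{\langle\mathbf Q\rangle}[x]$ is the Lie algebra over $\mathbb C$ with generators $\mathcal X^{\pm}_{i,t}$ ($1\le i\le m-1$, $t\ge 0$) and $\mathcal I_{j,t}$ ($1\le j\le m$, $t\ge 0$) and, for all admissible indices, the defining relations $$[\mathcal I_{i,s},\mathcal I_{j,t}]=0,\qquad [\mathcal I_{j,s},\mathcal X^{\pm}_{i,t}]=\pm a'_{ji}\,\mathcal X^{\pm}_{i,s+t},\qquad [\mathcal X^+_{i,t},\mathcal X^-_{j,s}]=\delta_{ij}(\mathcal J_{i,s+t}-Q_i\,\mathcal J_{i,s+t+1}),$$ $$[\mathcal X^{\pm}_{i,t},\mathcal X^{\pm}_{j,s}]=0\ \ (j\ne i\pm1),\qquad [\mathcal X^{+}_{i,t+1},\mathcal X^{+}_{j,s}]=[\mathcal X^{+}_{i,t},\mathcal X^{+}_{j,s+1}],\quad [\mathcal X^{-}_{i,t+1},\mathcal X^{-}_{j,s}]=[\mathcal X^{-}_{i,t},\mathcal X^{-}_{j,s+1}]\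 \ (j=i\pm 1),$$ $$[\mathcal X^{+}_{i,s},[\mathcal X^{+}_{i,t},\mathcal X^{+}_{j,u}]]=[\mathcal X^{-}_{i,s},[\mathcal X^{-}_{i,t},\mathcal X^{-}_{j,u}]]=0\ \ (j=i\pm1),$$ where $\mathcal J_{i,t}=\mathcal I_{i,t}-\mathcal I_{i+1,t}$, and $a'_{ji}=1$ if $j=i$, $a'_{ji}=-1$ if $j=i+1$, and $a'_{ji}=0$ otherwise. Let $U$ be its universal enveloping algebra. A $U$-module $M$ is a highest weight module of highest weight $\tilde{\mathbf u}=(\tilde u_{j,t})_{1\le j\le m,\,t\ge0}$, $\tilde u_{j,t}\in\mathbb C$, if it is generated by an element $v_0$ with $\mathcal X^+_{i,t}v_0=0$ and $\mathcal I_{j,t}v_0=\tilde u_{j,t}v_0$ for all $i,j,t$. The Verma module $\mathcal M(\tilde{\mathbf u})$ is the quotient of $U$ by the left ideal generated by all $\mathcal X^+_{i,t}$ and all $\mathcal I_{j,t}-\tilde u_{j,t}$, and $\mathcal L(\tilde{\mathbf u})$ is the quotient of $\mathcal M(\tilde{\mathbf u})$ by its largest proper submodule (the sum of all its proper submodules).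 For $Q\in\mathbb C$ let $\mathbb C[x]^{\langle Q\rangle}_{\rm monic}$ be the set of all monic polynomials in $\mathbb C[x]$ if $Q=0$, and of those for which $Q^{-1}$ is not a root if $Q\neq0$; let $\mathbb B^{\langle Q\rangle}=\{0\}$ if $Q=0$ and $\mathbb B^{\langle Q\rangle}=\mathbb C$ if $Q\ne0$. Let $$(\boldsymbol\varphi,\boldsymbol\beta,\mathbf h)=\big((\varphi_i,\beta_i)_{1\le i\le m-1},(h_t)_{t\ge0}\big)\in P:=\prod_{i=1}^{m-1}\big(\mathbb C[x]^{\langle Q_i\rangle}_{\rm monic}\times\mathbb B^{\langle Q_i\rangle}\big)\times\prod_{t\ge0}\mathbb C .$$ Writing $\varphi_i=(x-\gamma_{i,1})\cdots(x-\gamma_{i,n_i})$, put $u_{i,0}=n_i+\beta_i$ and, for $t>0$, $u_{i,t}=\gamma_{i,1}^t+\dots+\gamma_{i,n_i}^t$ if $Q_i=0$ and $u_{i,t}=\gamma_{i,1}^t+\dots+\gamma_{i,n_i}^t+Q_i^{-t}\beta_i$ if $Q_i\ne0$. Define $\tilde{\mathbf u}^{\langle\mathbf Q\rangle}(\boldsymbol\varphi,\boldsymbol\beta,\mathbf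 h)=(\tilde u_{j,t})_{1\le j\le m,\,t\ge0}$ by $$\tilde u_{j,t}=\sum_{k=j}^{m-1}u_{k,t}+h_t\quad(1\le j\le m),$$ so that $\tilde u_{m,t}=h_t$. Theorem. (1) For every $(\boldsymbol\varphi,\boldsymbol\beta,\mathbf h)\in P$ the module $\mathcal L(\tilde{\mathbf u}^{\langle\mathbf Q\rangle}(\boldsymbol\varphi,\boldsymbol\beta,\mathbf h))$ is a simple highest weight $U$-module of highest weight $\tilde{\mathbf u}^{\langle\mathbf Q\rangle}(\boldsymbol\varphi,\boldsymbol\beta,\mathbf h)$, and it is finite dimensional over $\mathbb C$. (2) For $(\boldsymbol\varphi,\boldsymbol\beta,\mathbf h),(\boldsymbol\varphi',\boldsymbol\beta',\mathbf h')\in P$, $$\mathcal L(\tilde{\mathbf u}^{\langle\mathbf Q\rangle}(\boldsymbol\varphi,\boldsymbol\beta,\mathbf h))\cong\mathcal L(\tilde{\mathbf u}^{\langle\mathbf Q\rangle}(\boldsymbol\varphi',\boldsymbol\beta',\mathbf h'))\iff(\boldsymbol\varphi,\boldsymbol\beta,\mathbf h)=(\boldsymbol\varphi',\boldsymbol\beta',\mathbf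 h').$$ (3) Every finite dimensional simple $U$-module is isomorphic to $\mathcal L(\tilde{\mathbf u}^{\langle\mathbf Q\rangle}(\boldsymbol\varphi,\boldsymbol\beta,\mathbf h))$ for some $(\boldsymbol\varphi,\boldsymbol\beta,\mathbf h)\in P$. Consequently the modules $\mathcal L(\tilde{\mathbf u}^{\langle\mathbf Q\rangle}(\boldsymbol\varphi,\boldsymbol\beta,\mathbf h))$, $(\boldsymbol\varphi,\boldsymbol\beta,\mathbf h)\in P$, form a complete set of isomorphism classes of finite dimensional simple $U$-modules. -/

import Mathlib

open Polynomial

noncomputable section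

namespace DeformedCurrent

/-! Throughout `m = n + 1`: the nodes `1, …, m - 1` are indexed by `Fin n` and the indices
`1, …, m` by `Fin (n + 1)`.  The node `i : Fin n` corresponds to the pair of indices
`i.castSucc` ("`i`") and `i.succ` ("`i + 1`"). -/

/-- The generators `X⁺_{i,t}`, `X⁻_{i,t}` and `I_{j,t}`. -/
inductive Gen (n : ℕ) : Type
  | Xp (i : Fin n) (t : ℕ) : Gen n
  | Xm (i : Fin n) (t : ℕ) : Gen n
  | I (j : Fin (n + 1)) (t : ℕ) : Gen n

/-- The integers `a'_{ji}`: `1` if `j = i`, `-1` if `j = i + 1`, and `0` otherwise. -/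
def aCoeff {n : ℕ} (j : Fin (n + 1)) (i : Fin n) : ℂ :=
  if j = i.castSucc then 1 else if j = i.succ then -1 else 0

/-- `j = i ± 1`. -/
def Adj {n : ℕ} (i j : Fin n) : Prop := (j : ℕ) = i + 1 ∨ (i : ℕ) = j + 1

/-- The free Lie algebra on the generators. -/
abbrev Free (n : ℕ) : Type := FreeLieAlgebra ℂ (Gen n)

/-- `X⁺_{i,t}` in the free Lie algebra. -/
def fXp {n : ℕ} (i : Fin n) (t : ℕ) : Free n := FreeLieAlgebra.of ℂ (Gen.Xp i t)

/-- `X⁻_{i,t}` in the free Lie algebra. -/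
def fXm {n : ℕ} (i : Fin n) (t : ℕ) : Free n := FreeLieAlgebra.of ℂ (Gen.Xm i t)

/-- `I_{j,t}` in the free Lie algebra. -/
def fI {n : ℕ} (j : Fin (n + 1)) (t : ℕ) : Free n := FreeLieAlgebra.of ℂ (Gen.I j t)

/-- `J_{i,t} = I_{i,t} - I_{i+1,t}` in the free Lie algebra. -/
def fJ {n : ℕ} (i : Fin n) (t : ℕ) : Free n := fI i.castSucc t - fI i.succ t

/-- `IsRelator Q x` means that `x = 0` is one of the defining relations of the deformed current
Lie algebra of `gl_m` with deformation parameters `Q`. -/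
inductive IsRelator {n : ℕ} (Q : Fin n → ℂ) : Free n → Prop
  | II (i j : Fin (n + 1)) (s t : ℕ) : IsRelator Q ⁅fI i s, fI j t⁆
  | IXp (j : Fin (n + 1)) (i : Fin n) (s t : ℕ) :
      IsRelator Q (⁅fI j s, fXp i t⁆ - aCoeff j i • fXp i (s + t))
  | IXm (j : Fin (n + 1)) (i : Fin n) (s t : ℕ) :
      IsRelator Q (⁅fI j s, fXm i t⁆ + aCoeff j i • fXm i (s + t))
  | XpXm_same (i : Fin n) (t s : ℕ) :
      IsRelator Q (⁅fXp i t, fXm i s⁆ - (fJ i (s + t) - Q i • fJ i (s + t + 1)))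
  | XpXm_ne (i j : Fin n) (t s : ℕ) (h : i ≠ j) : IsRelator Q ⁅fXp i t, fXm j s⁆
  | XpXp (i j : Fin n) (t s : ℕ) (h : ¬ Adj i j) : IsRelator Q ⁅fXp i t, fXp j s⁆
  | XmXm (i j : Fin n) (t s : ℕ) (h : ¬ Adj i j) : IsRelator Q ⁅fXm i t, fXm j s⁆
  | shiftXp (i j : Fin n) (t s : ℕ) (h : Adj i j) :
      IsRelator Q (⁅fXp i (t + 1), fXp j s⁆ - ⁅fXp i t, fXp j (s + 1)⁆)
  | shiftXm (i j : Fin n) (t s : ℕ) (h : Adj i j) :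
      IsRelator Q (⁅fXm i (t + 1), fXm j s⁆ - ⁅fXm i t, fXm j (s + 1)⁆)
  | serreXp (i j : Fin n) (s t u : ℕ) (h : Adj i j) :
      IsRelator Q ⁅fXp i s, ⁅fXp i t, fXp j u⁆⁆
  | serreXm (i j : Fin n) (s t u : ℕ) (h : Adj i j) :
      IsRelator Q ⁅fXm i s, ⁅fXm i t, fXm j u⁆⁆

/-- The ideal of the free Lie algebra generated by the defining relations. -/
def relIdeal {n : ℕ} (Q : Fin n → ℂ) : LieIdeal ℂ (Free n) :=
  LieSubmodule.lieSpan ℂ (Free n) {x | IsRelator Q x}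

/-- The deformed current Lie algebra `gl_m^⟨Q⟩[x]`. -/
def DeformedGL {n : ℕ} (Q : Fin n → ℂ) : Type := Free n ⧸ relIdeal Q

instance {n : ℕ} (Q : Fin n → ℂ) : LieRing (DeformedGL Q) :=
  inferInstanceAs (LieRing (Free n ⧸ relIdeal Q))

instance {n : ℕ} (Q : Fin n → ℂ) : LieAlgebra ℂ (DeformedGL Q) :=
  inferInstanceAs (LieAlgebra ℂ (Free n ⧸ relIdeal Q))

/-- The quotient map from the free Lie algebra. -/
def toDeformedGL {n : ℕ} (Q : Fin n → ℂ) : Free n →ₗ⁅ℂ⁆ DeformedGL Q where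
  toFun x := (LieSubmodule.Quotient.mk x : Free n ⧸ relIdeal Q)
  map_add' _ _ := rfl
  map_smul' _ _ := rfl
  map_lie' := rfl

/-- The universal enveloping algebra `U(gl_m^⟨Q⟩[x])`. -/
abbrev U {n : ℕ} (Q : Fin n → ℂ) : Type := UniversalEnvelopingAlgebra ℂ (DeformedGL Q)

/-- `X⁺_{i,t}` in the enveloping algebra. -/
def Xp {n : ℕ} (Q : Fin n → ℂ) (i : Fin n) (t : ℕ) : U Q :=
  UniversalEnvelopingAlgebra.ι ℂ (toDeformedGL Q (fXp i t))

/-- `X⁻_{i,t}` in the enveloping algebra. -/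
def Xm {n : ℕ} (Q : Fin n → ℂ) (i : Fin n) (t : ℕ) : U Q :=
  UniversalEnvelopingAlgebra.ι ℂ (toDeformedGL Q (fXm i t))

/-- `I_{j,t}` in the enveloping algebra. -/
def I {n : ℕ} (Q : Fin n → ℂ) (j : Fin (n + 1)) (t : ℕ) : U Q :=
  UniversalEnvelopingAlgebra.ι ℂ (toDeformedGL Q (fI j t))

/-- `M` is a highest weight module of highest weight `w = (w_{j,t})`. -/
def IsHighestWeightModule {n : ℕ} (Q : Fin n → ℂ) (w : Fin (n + 1) → ℕ → ℂ)
    (M : Type*) [AddCommGroup M] [Module ℂ M] [Module (U Q) M] : Prop :=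
  ∃ v : M, Submodule.span (U Q) {v} = ⊤ ∧ (∀ i t, Xp Q i t • v = 0) ∧
    ∀ j t, I Q j t • v = w j t • v

/-- The left ideal generated by all `X⁺_{i,t}` and all `I_{j,t} - w_{j,t}`. -/
def vermaIdeal {n : ℕ} (Q : Fin n → ℂ) (w : Fin (n + 1) → ℕ → ℂ) : Submodule (U Q) (U Q) :=
  Submodule.span (U Q)
    ({x | ∃ i t, x = Xp Q i t} ∪ {x | ∃ j t, x = I Q j t - algebraMap ℂ (U Q) (w j t)})

/-- The Verma module of highest weight `w`. -/
abbrev Verma {n : ℕ} (Q : Fin n → ℂ) (w : Fin (n + 1) → ℕ → ℂ) : Type := U Q ⧸ vermaIdeal Q w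

/-- The largest proper submodule of the Verma module, as the sum of all proper submodules. -/
def vermaRad {n : ℕ} (Q : Fin n → ℂ) (w : Fin (n + 1) → ℕ → ℂ) :
    Submodule (U Q) (Verma Q w) :=
  sSup {N | N ≠ ⊤}

/-- The simple highest weight module `L(w)`: the quotient of the Verma module by its largest proper
submodule. -/
abbrev L {n : ℕ} (Q : Fin n → ℂ) (w : Fin (n + 1) → ℕ → ℂ) : Type := Verma Q w ⧸ vermaRad Q w

/-- Monic complex polynomials that, if `q ≠ 0`, do not have `q⁻¹` as a root. -/
def monicSet (q : ℂ) : Set ℂ[X] := {φ | φ.Monic ∧ (q ≠ 0 → ¬ φ.IsRoot q⁻¹)}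

/-- The set `{0}` if `q = 0`, and all of `ℂ` if `q ≠ 0`. -/
def betaSet (q : ℂ) : Set ℂ := {b | q = 0 → b = 0}

/-- The parameter set: families of pairs `(φ_i, β_i)` together with a sequence `h`. -/
abbrev Param {n : ℕ} (Q : Fin n → ℂ) : Type :=
  ((i : Fin n) → monicSet (Q i) × betaSet (Q i)) × (ℕ → ℂ)

/-- The power sum `γ_1 ^ t + ⋯ + γ_d ^ t` of the roots of `φ`, with multiplicity. -/
def powerSum (φ : ℂ[X]) (t : ℕ) : ℂ := (φ.roots.map (fun γ => γ ^ t)).sum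

/-- The sequence `u^⟨q⟩(φ, β)`. -/
def rankOneWeight (q : ℂ) (φ : ℂ[X]) (β : ℂ) (t : ℕ) : ℂ :=
  if t = 0 then (φ.natDegree : ℂ) + β
  else if q = 0 then powerSum φ t
  else powerSum φ t + (q⁻¹) ^ t * β

/-- The highest weight `ũ_{j,t} = ∑_{k ≥ j} u_{k,t} + h_t`; the sum is empty for the last `j`. -/
def weight {n : ℕ} (Q : Fin n → ℂ) (p : Param Q) (j : Fin (n + 1)) (t : ℕ) : ℂ :=
  (∑ k : Fin n with j ≤ k.castSucc, rankOneWeight (Q k) (p.1 k).1 (p.1 k).2 t) + p.2 t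

end DeformedCurrent

end

open DeformedCurrent

/-!
The grading element `height = -∑_j j I_{j,0}` satisfies `[height, X^±_{i,t}] = ±X^±_{i,t}`. Hence a
module generated by singular vectors of height `μ` is obtained by applying the `X⁻_{i,t}` alone, and
modulo these singular vectors all of it has heights `μ - 1, μ - 2, …`
(`exists_lowerPoly_smul_eq_zero`). Polynomials in `height` therefore isolate the highest weight
component, so that the sum of all proper submodules of a nonzero Verma module is proper
(`IsHighestWeightVector.sSup_ne_top`), highest weights of simple modules are unique
(`IsHighestWeightVector.weight_unique`), and a simple highest weight module has no singular vectors
one step below the top (`IsHighestWeightVector.eq_zero_of_singular`). No basis theorem for the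
enveloping algebra is needed: the Verma modules in question are nonzero because they map onto
concrete modules.

*Finite dimensionality.* The weights of the parametrized family are sums of weights of three kinds:
fundamental weights evaluated at a point, realized in the exterior algebra of `ℂ ^ m`, where the
matrix unit `E_{a,b}` acts as exterior multiplication by `e_a` after contraction with `e_b`; weights
supported at the zero of `1 - Q_i x`, which are one dimensional; and the one dimensional weights
`h`. Weights of highest weight vectors add up in tensor products (`Realizable.add`), and `L` is a
quotient of the submodule generated by such a vector.

*Distinctness.* Exponential sequences `t ↦ γ ^ t` are linearly independent
(`eq_of_rankOneWeight_eq`).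

*Exhaustion.* A finite dimensional simple module has a highest weight vector `v`. Fix a node `i`,
put `q = Q_i`, and let `u` be the functional `X ^ t ↦ w_{i,t} - w_{i+1,t}`. The polynomials `b`
with `(X⁻_i ⊗ b) v = 0` form a nonzero ideal `(f)`, and by the absence of singular vectors `f ∣ b`
if and only if `u` vanishes on all `(1 - q x) a b` (`IsHighestWeightVector.mem_annIdeal_iff`). If
`g = (1 - q x) a b` and `g b ≡ c b` modulo `f`, then `X⁺_i ⊗ a`, `X⁻_i ⊗ b` and `J_i ⊗ g` act like
an `sl₂`-triple scaled by `c`, so that nilpotency gives `u g = k c` with `k` a natural number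
(`IsHighestWeightVector.exists_nat_nodeFunctional_eq`). The case `c = 0` shows that `f` is
squarefree and does not vanish at `q⁻¹`; the case `c = 1`, applied to interpolation polynomials,
shows that `u` is a combination of evaluations at the roots of `f`, with natural coefficients, and
at `q⁻¹` (`exists_rankOneWeight_eq`).
-/

noncomputable section

namespace DeformedCurrent

attribute [local instance 100] LieRing.ofAssociativeRing

variable {n : ℕ} {Q : Fin n → ℂ}

/-! ### Relations in the enveloping algebra -/

theorem toDeformedGL_eq_zero {x : Free n} (h : IsRelator Q x) : toDeformedGL Q x = 0 :=
  (LieSubmodule.Quotient.mk_eq_zero (N := relIdeal Q)).2 (LieSubmodule.subset_lieSpan h)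

/-- The composite of the quotient map with the canonical map to the enveloping algebra. -/
def toU (Q : Fin n → ℂ) : Free n →ₗ⁅ℂ⁆ U Q :=
  (UniversalEnvelopingAlgebra.ι ℂ).comp (toDeformedGL Q)

theorem toU_eq_zero {x : Free n} (h : IsRelator Q x) : toU Q x = 0 := by
  rw [toU, LieHom.comp_apply, toDeformedGL_eq_zero h, map_zero]

theorem I_mul_I (i j : Fin (n + 1)) (s t : ℕ) : I Q i s * I Q j t = I Q j t * I Q i s := by
  have h := toU_eq_zero (Q := Q) (.II i j s t)
  rw [LieHom.map_lie, LieRing.of_associative_ring_bracket, sub_eq_zero] at h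
  exact h

theorem I_mul_Xp (j : Fin (n + 1)) (i : Fin n) (s t : ℕ) :
    I Q j s * Xp Q i t = Xp Q i t * I Q j s + aCoeff j i • Xp Q i (s + t) := by
  have h := toU_eq_zero (Q := Q) (.IXp j i s t)
  rw [map_sub, map_smul, LieHom.map_lie, LieRing.of_associative_ring_bracket, sub_eq_zero,
    sub_eq_iff_eq_add'] at h
  exact h

theorem I_mul_Xm (j : Fin (n + 1)) (i : Fin n) (s t : ℕ) :
    I Q j s * Xm Q i t = Xm Q i t * I Q j s - aCoeff j i • Xm Q i (s + t) := by
  have h := toU_eq_zero (Q := Q) (.IXm j i s t)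
  rw [map_add, map_smul, LieHom.map_lie, LieRing.of_associative_ring_bracket,
    ← eq_neg_iff_add_eq_zero, sub_eq_iff_eq_add', ← sub_eq_add_neg] at h
  exact h

/-- `J_{i,t} = I_{i,t} - I_{i+1,t}` in the enveloping algebra. -/
def J (Q : Fin n → ℂ) (i : Fin n) (t : ℕ) : U Q := I Q i.castSucc t - I Q i.succ t

theorem Xp_mul_Xm_same (i : Fin n) (t s : ℕ) :
    Xp Q i t * Xm Q i s =
      Xm Q i s * Xp Q i t + (J Q i (s + t) - Q i • J Q i (s + t + 1)) := by
  have h := toU_eq_zero (Q := Q) (.XpXm_same i t s)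
  rw [map_sub, map_sub, map_smul, LieHom.map_lie, LieRing.of_associative_ring_bracket, sub_eq_zero,
    sub_eq_iff_eq_add', fJ, map_sub, fJ, map_sub] at h
  exact h

theorem Xp_mul_Xm_ne {i j : Fin n} (hij : i ≠ j) (t s : ℕ) :
    Xp Q i t * Xm Q j s = Xm Q j s * Xp Q i t := by
  have h := toU_eq_zero (Q := Q) (.XpXm_ne i j t s hij)
  rw [LieHom.map_lie, LieRing.of_associative_ring_bracket, sub_eq_zero] at h
  exact h

theorem not_adj_self (i : Fin n) : ¬ Adj i i := by
  unfold Adj; omega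

theorem Xm_mul_Xm_same (i : Fin n) (t s : ℕ) : Xm Q i t * Xm Q i s = Xm Q i s * Xm Q i t := by
  have h := toU_eq_zero (Q := Q) (.XmXm i i t s (not_adj_self i))
  rw [LieHom.map_lie, LieRing.of_associative_ring_bracket, sub_eq_zero] at h
  exact h

theorem aCoeff_castSucc (i : Fin n) : aCoeff i.castSucc i = 1 := by simp [aCoeff]

theorem aCoeff_succ (i : Fin n) : aCoeff i.succ i = -1 := by
  rw [aCoeff, if_neg i.castSucc_lt_succ.ne', if_pos rfl]

theorem J_mul_Xm (i : Fin n) (s t : ℕ) :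
    J Q i s * Xm Q i t = Xm Q i t * J Q i s - (2 : ℂ) • Xm Q i (s + t) := by
  rw [J, sub_mul, I_mul_Xm, I_mul_Xm, aCoeff_castSucc, aCoeff_succ, mul_sub]
  module

/-- The grading element `-∑_j j I_{j,0}`: its commutator with `X^±_{i,t}` is `±X^±_{i,t}`. -/
def height (Q : Fin n → ℂ) : U Q := ∑ j : Fin (n + 1), (-(j : ℕ) : ℂ) • I Q j 0

theorem sum_height_aCoeff (i : Fin n) :
    ∑ j : Fin (n + 1), (-(j : ℕ) : ℂ) * aCoeff j i = 1 := by
  have h : ∀ j : Fin (n + 1), (-(j : ℕ) : ℂ) * aCoeff j i =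
      (if j = i.castSucc then -(j : ℕ) else 0 : ℂ) + (if j = i.succ then (j : ℕ) else 0 : ℂ) := by
    intro j
    rw [aCoeff]
    by_cases h1 : j = i.castSucc
    · have h2 : j ≠ i.succ := h1 ▸ i.castSucc_lt_succ.ne
      simp [if_pos h1, if_neg h2]
    · by_cases h2 : j = i.succ
      · simp [if_neg h1, if_pos h2]
      · simp [if_neg h1, if_neg h2]
  rw [Finset.sum_congr rfl fun j _ => h j, Finset.sum_add_distrib, Finset.sum_ite_eq',
    Finset.sum_ite_eq']
  simp

theorem height_mul_I (j : Fin (n + 1)) (t : ℕ) : height Q * I Q j t = I Q j t * height Q := by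
  simp only [height, Finset.sum_mul, Finset.mul_sum, smul_mul_assoc, mul_smul_comm]
  exact Finset.sum_congr rfl fun k _ => by rw [I_mul_I]

theorem height_mul_Xp (i : Fin n) (t : ℕ) :
    height Q * Xp Q i t = Xp Q i t * height Q + Xp Q i t := by
  simp only [height, Finset.sum_mul, Finset.mul_sum, smul_mul_assoc, mul_smul_comm, I_mul_Xp,
    smul_add, Finset.sum_add_distrib, zero_add, smul_smul]
  rw [← Finset.sum_smul, sum_height_aCoeff, one_smul]

theorem height_mul_Xm (i : Fin n) (t : ℕ) :
    height Q * Xm Q i t = Xm Q i t * height Q - Xm Q i t := by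
  simp only [height, Finset.sum_mul, Finset.mul_sum, smul_mul_assoc, mul_smul_comm, I_mul_Xm,
    smul_sub, Finset.sum_sub_distrib, zero_add, smul_smul]
  rw [← Finset.sum_smul, sum_height_aCoeff, one_smul]

/-- The enveloping algebra is generated as an algebra by the images of the generators. -/
theorem mem_of_generators_mem (T : Subalgebra ℂ (U Q)) (hp : ∀ i t, Xp Q i t ∈ T)
    (hm : ∀ i t, Xm Q i t ∈ T) (hI : ∀ j t, I Q j t ∈ T) (x : U Q) : x ∈ T := by
  let F : Free n →ₗ⁅ℂ⁆ T := FreeLieAlgebra.lift ℂ fun g => match g with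
    | .Xp i t => ⟨Xp Q i t, hp i t⟩
    | .Xm i t => ⟨Xm Q i t, hm i t⟩
    | .I j t => ⟨I Q j t, hI j t⟩
  have hF : ∀ y, (F y : U Q) = toU Q y := by
    intro y
    have : (T.val : T →ₗ⁅ℂ⁆ U Q).comp F = toU Q := by
      refine FreeLieAlgebra.hom_ext fun g => ?_
      rw [LieHom.comp_apply, FreeLieAlgebra.lift_of_apply]
      cases g <;> rfl
    exact LieHom.congr_fun this y
  have hsurj : ∀ z : DeformedGL Q, UniversalEnvelopingAlgebra.ι ℂ z ∈ T := by
    intro z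
    obtain ⟨y, rfl⟩ := LieSubmodule.Quotient.surjective_mk' (relIdeal Q) z
    have := (F y).2
    rw [hF y] at this
    exact this
  let G : DeformedGL Q →ₗ⁅ℂ⁆ T :=
    { toFun := fun z => ⟨UniversalEnvelopingAlgebra.ι ℂ z, hsurj z⟩
      map_add' := fun a b => Subtype.ext (map_add _ a b)
      map_smul' := fun a b => Subtype.ext (map_smul _ a b)
      map_lie' := fun {a b} => Subtype.ext (LieHom.map_lie _ a b) }
  have h : T.val.comp (UniversalEnvelopingAlgebra.lift ℂ G) = AlgHom.id ℂ (U Q) := by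
    refine UniversalEnvelopingAlgebra.hom_ext ℂ (LieHom.ext fun z => ?_)
    change T.val (UniversalEnvelopingAlgebra.lift ℂ G (UniversalEnvelopingAlgebra.ι ℂ z)) = _
    rw [UniversalEnvelopingAlgebra.lift_ι_apply]
    rfl
  have hx := DFunLike.congr_fun h x
  change (UniversalEnvelopingAlgebra.lift ℂ G x : U Q) = x at hx
  exact hx ▸ (UniversalEnvelopingAlgebra.lift ℂ G x).2

section Module

variable {M : Type*} [AddCommGroup M] [Module ℂ M] [Module (U Q) M] [IsScalarTower ℂ (U Q) M]

/-- A complex subspace stable under the generators is stable under the enveloping algebra. -/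
theorem smul_mem_of_generators (N : Submodule ℂ M) (hp : ∀ i t, ∀ m ∈ N, Xp Q i t • m ∈ N)
    (hm : ∀ i t, ∀ m ∈ N, Xm Q i t • m ∈ N) (hI : ∀ j t, ∀ m ∈ N, I Q j t • m ∈ N)
    (x : U Q) {m : M} (hmN : m ∈ N) : x • m ∈ N := by
  let T : Subalgebra ℂ (U Q) :=
    { carrier := {x | ∀ m ∈ N, x • m ∈ N}
      mul_mem' := fun {a b} ha hb m hm => by rw [mul_smul]; exact ha _ (hb _ hm)
      add_mem' := fun {a b} ha hb m hm => by rw [add_smul]; exact N.add_mem (ha _ hm) (hb _ hm)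
      algebraMap_mem' := fun c m hm => by rw [algebraMap_smul]; exact N.smul_mem c hm }
  exact mem_of_generators_mem T hp hm hI x m hmN

end Module

/-- Operators satisfying the defining relations give a representation of the deformed current
Lie algebra. -/
theorem exists_lieHom {A : Type*} [Ring A] [Algebra ℂ A] (f : Gen n → A)
    (h : ∀ x, IsRelator Q x → FreeLieAlgebra.lift ℂ f x = 0) :
    ∃ ρ : DeformedGL Q →ₗ⁅ℂ⁆ A, (∀ i t, ρ (toDeformedGL Q (fXp i t)) = f (.Xp i t)) ∧
      (∀ i t, ρ (toDeformedGL Q (fXm i t)) = f (.Xm i t)) ∧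
      ∀ j t, ρ (toDeformedGL Q (fI j t)) = f (.I j t) := by
  have hle : relIdeal Q ≤ (FreeLieAlgebra.lift ℂ f).ker :=
    LieSubmodule.lieSpan_le.2 fun x hx => LieHom.mem_ker.2 (h x hx)
  let g : DeformedGL Q →ₗ[ℂ] A :=
    (relIdeal Q).toSubmodule.liftQ (FreeLieAlgebra.lift ℂ f : Free n →ₗ[ℂ] A) fun x hx =>
      LieHom.mem_ker.1 (hle hx)
  have hg : ∀ y, g (toDeformedGL Q y) = FreeLieAlgebra.lift ℂ f y := fun y => rfl
  refine ⟨{ g with map_lie' := ?_ }, ?_, ?_, ?_⟩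
  · intro a b
    obtain ⟨a, rfl⟩ := LieSubmodule.Quotient.surjective_mk' (relIdeal Q) a
    obtain ⟨b, rfl⟩ := LieSubmodule.Quotient.surjective_mk' (relIdeal Q) b
    change g ⁅toDeformedGL Q a, toDeformedGL Q b⁆ = ⁅g (toDeformedGL Q a), g (toDeformedGL Q b)⁆
    rw [← LieHom.map_lie, hg, hg, hg, LieHom.map_lie]
  · exact fun i t => (hg _).trans (FreeLieAlgebra.lift_of_apply ..)
  · exact fun i t => (hg _).trans (FreeLieAlgebra.lift_of_apply ..)
  · exact fun i t => (hg _).trans (FreeLieAlgebra.lift_of_apply ..)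

/-! ### Highest weight modules -/

section Module

variable {M : Type*} [AddCommGroup M] [Module ℂ M] [Module (U Q) M]

/-- `lowering Q S k` is spanned by the vectors `X⁻ ⋯ X⁻ s` with `k` factors and `s ∈ S`. -/
def lowering (Q : Fin n → ℂ) {M : Type*} [AddCommGroup M] [Module ℂ M] [Module (U Q) M]
    (S : Submodule ℂ M) : ℕ → Submodule ℂ M
  | 0 => S
  | k + 1 => Submodule.span ℂ {x | ∃ i t, ∃ m ∈ lowering Q S k, x = Xm Q i t • m}

theorem Xm_smul_mem_lowering {S : Submodule ℂ M} {k : ℕ} {m : M} (hm : m ∈ lowering Q S k)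
    (i : Fin n) (t : ℕ) : Xm Q i t • m ∈ lowering Q S (k + 1) :=
  Submodule.subset_span ⟨i, t, m, hm, rfl⟩

variable [IsScalarTower ℂ (U Q) M]

theorem smul_comm_complex (c : ℂ) (x : U Q) (m : M) : x • c • m = c • x • m := by
  rw [← algebraMap_smul (U Q) c m, ← algebraMap_smul (U Q) c (x • m), ← mul_smul, ← mul_smul,
    Algebra.commutes]

/-- To show that an element of the enveloping algebra maps `lowering Q S (k + 1)` to a subspace,
it suffices to look at the spanning vectors. -/
theorem smul_mem_of_mem_lowering_succ {S N : Submodule ℂ M} {k : ℕ} (x : U Q)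
    (h : ∀ i t, ∀ m ∈ lowering Q S k, x • Xm Q i t • m ∈ N) {m : M}
    (hm : m ∈ lowering Q S (k + 1)) : x • m ∈ N := by
  have hle : lowering Q S (k + 1) ≤ N.comap (Algebra.lsmul ℂ ℂ M x) := by
    refine Submodule.span_le.2 ?_
    rintro _ ⟨i, t, m, hm, rfl⟩
    exact h i t m hm
  exact hle hm

theorem I_smul_mem_lowering {S : Submodule ℂ M} (hI : ∀ j t, ∀ m ∈ S, I Q j t • m ∈ S) (k : ℕ) :
    ∀ j t, ∀ m ∈ lowering Q S k, I Q j t • m ∈ lowering Q S k := by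
  induction k with
  | zero => exact hI
  | succ k ih =>
    intro j t m hm
    refine smul_mem_of_mem_lowering_succ _ (fun i s m hm => ?_) hm
    rw [← mul_smul, I_mul_Xm, sub_smul, mul_smul, smul_assoc]
    exact sub_mem (Xm_smul_mem_lowering (ih j t m hm) i s)
      (Submodule.smul_mem _ _ (Xm_smul_mem_lowering hm i _))

theorem J_smul_mem_lowering {S : Submodule ℂ M} (hI : ∀ j t, ∀ m ∈ S, I Q j t • m ∈ S) (k : ℕ)
    (i : Fin n) (t : ℕ) {m : M} (hm : m ∈ lowering Q S k) : J Q i t • m ∈ lowering Q S k := by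
  rw [J, sub_smul]
  exact sub_mem (I_smul_mem_lowering hI k _ _ _ hm) (I_smul_mem_lowering hI k _ _ _ hm)

/-- The commutator of a raising and a lowering generator preserves the number of lowering
operators. -/
theorem commutator_smul_mem_lowering {S : Submodule ℂ M}
    (hI : ∀ j t, ∀ m ∈ S, I Q j t • m ∈ S) (k : ℕ) (i j : Fin n) (t s : ℕ) {m : M}
    (hm : m ∈ lowering Q S k) :
    Xp Q i t • Xm Q j s • m - Xm Q j s • Xp Q i t • m ∈ lowering Q S k := by
  rw [← mul_smul, ← mul_smul]
  by_cases hij : i = j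
  · subst hij
    rw [Xp_mul_Xm_same, add_smul, add_sub_cancel_left, sub_smul, smul_assoc]
    exact sub_mem (J_smul_mem_lowering hI k _ _ hm)
      (Submodule.smul_mem _ _ (J_smul_mem_lowering hI k _ _ hm))
  · rw [Xp_mul_Xm_ne hij, sub_self]
    exact zero_mem _

theorem Xp_smul_mem_lowering {S : Submodule ℂ M} (hI : ∀ j t, ∀ m ∈ S, I Q j t • m ∈ S)
    (hX : ∀ i t, ∀ m ∈ S, Xp Q i t • m = 0) (k : ℕ) :
    ∀ i t, ∀ m ∈ lowering Q S (k + 1), Xp Q i t • m ∈ lowering Q S k := by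
  induction k with
  | zero =>
    intro i t m hm
    refine smul_mem_of_mem_lowering_succ _ (fun j s m hm => ?_) hm
    have h := commutator_smul_mem_lowering hI 0 i j t s hm
    rwa [hX i t m hm, smul_zero, sub_zero] at h
  | succ k ih =>
    intro i t m hm
    refine smul_mem_of_mem_lowering_succ _ (fun j s m hm => ?_) hm
    have h := commutator_smul_mem_lowering hI (k + 1) i j t s hm
    exact (Submodule.sub_mem_iff_left _ (Xm_smul_mem_lowering (ih i t m hm) j s)).1 h

theorem height_smul_lowering {S : Submodule ℂ M} {μ : ℂ} (hμ : ∀ m ∈ S, height Q • m = μ • m)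
    (k : ℕ) : ∀ m ∈ lowering Q S k, height Q • m = (μ - k) • m := by
  induction k with
  | zero => simpa [lowering] using hμ
  | succ k ih =>
    intro m hm
    rw [← sub_eq_zero]
    have h : (height Q - algebraMap ℂ (U Q) (μ - (k + 1 : ℕ))) • m ∈ (⊥ : Submodule ℂ M) := by
      refine smul_mem_of_mem_lowering_succ _ (fun i t m hm => ?_) hm
      rw [Submodule.mem_bot, sub_smul, ← mul_smul, height_mul_Xm, sub_smul, mul_smul, ih m hm,
        smul_comm_complex, algebraMap_smul]
      generalize Xm Q i t • m = x
      push_cast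
      module
    rwa [Submodule.mem_bot, sub_smul, algebraMap_smul] at h

/-- The submodule generated by a space of singular vectors is obtained by applying the lowering
operators alone. -/
theorem span_le_iSup_lowering {S : Submodule ℂ M} (hI : ∀ j t, ∀ m ∈ S, I Q j t • m ∈ S)
    (hX : ∀ i t, ∀ m ∈ S, Xp Q i t • m = 0) {m : M} (hm : m ∈ Submodule.span (U Q) (S : Set M)) :
    m ∈ ⨆ k, lowering Q S k := by
  have key : ∀ (x : U Q), (∀ k, ∀ m ∈ lowering Q S k, x • m ∈ ⨆ k, lowering Q S k) →
      ∀ m ∈ ⨆ k, lowering Q S k, x • m ∈ ⨆ k, lowering Q S k := fun x hx m hm =>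
    (iSup_le fun k m hm => hx k m hm :
      (⨆ k, lowering Q S k) ≤ (⨆ k, lowering Q S k).comap (Algebra.lsmul ℂ ℂ M x)) hm
  have stable := fun (x : U Q) {m : M} => smul_mem_of_generators (m := m) (⨆ k, lowering Q S k)
    (fun i t => key _ fun k m hm => by
      cases k with
      | zero => rw [hX i t m hm]; exact zero_mem _
      | succ k => exact Submodule.mem_iSup_of_mem k (Xp_smul_mem_lowering hI hX k i t m hm))
    (fun i t => key _ fun k m hm =>
      Submodule.mem_iSup_of_mem (k + 1) (Xm_smul_mem_lowering hm i t))
    (fun j t => key _ fun k m hm =>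
      Submodule.mem_iSup_of_mem k (I_smul_mem_lowering hI k j t m hm)) x
  induction hm using Submodule.span_induction with
  | mem x h => exact Submodule.mem_iSup_of_mem 0 h
  | zero => exact zero_mem _
  | add x y _ _ hx hy => exact add_mem hx hy
  | smul a x _ hx => exact stable a hx

/-- The polynomial with simple roots `μ - 1, …, μ - K`. -/
def lowerPoly (μ : ℂ) (K : ℕ) : ℂ[X] := ∏ k ∈ Finset.range K, (X - C (μ - (k + 1)))

theorem lowerPoly_dvd (μ : ℂ) {K K' : ℕ} (h : K ≤ K') : lowerPoly μ K ∣ lowerPoly μ K' :=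
  Finset.prod_dvd_prod_of_subset _ _ _ (Finset.range_mono h)

theorem eval_lowerPoly_eq_zero_iff (μ z : ℂ) (K : ℕ) :
    (lowerPoly μ K).eval z = 0 ↔ ∃ k < K, z = μ - (k + 1) := by
  simp [lowerPoly, eval_prod, Finset.prod_eq_zero_iff, sub_eq_zero]

theorem eval_lowerPoly_ne_zero (μ : ℂ) (d K : ℕ) : (lowerPoly μ K).eval (μ + d) ≠ 0 := by
  rw [Ne, eval_lowerPoly_eq_zero_iff]
  rintro ⟨k, -, hk⟩
  have : ((d + k + 1 : ℕ) : ℂ) = 0 := by push_cast; linear_combination hk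
  exact absurd (Nat.cast_eq_zero.1 this) (by omega)

theorem aeval_smul_of_smul_eq {x : U Q} {m : M} {μ : ℂ} (h : x • m = μ • m) (p : ℂ[X]) :
    aeval x p • m = p.eval μ • m := by
  induction p using Polynomial.induction_on with
  | C a => simp
  | add p q hp hq => rw [map_add, add_smul, hp, hq, eval_add, add_smul]
  | monomial k a ih =>
    rw [pow_succ, ← mul_assoc, map_mul, aeval_X, mul_smul, h, smul_comm_complex, ih, eval_mul_X,
      smul_smul, mul_comm]

/-- Modulo sums of eigenvectors of the grading element of eigenvalues `μ - 1, μ - 2, …`, every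
vector of the submodule generated by a space of singular vectors of height `μ` lies in that
space. -/
theorem exists_lowerPoly_smul_eq_zero {S : Submodule ℂ M}
    (hI : ∀ j t, ∀ m ∈ S, I Q j t • m ∈ S) (hX : ∀ i t, ∀ m ∈ S, Xp Q i t • m = 0) {μ : ℂ}
    (hμ : ∀ m ∈ S, height Q • m = μ • m) {m : M} (hm : m ∈ Submodule.span (U Q) (S : Set M)) :
    ∃ s ∈ S, ∃ K, aeval (height Q) (lowerPoly μ K) • (m - s) = 0 := by
  refine Submodule.iSup_induction (lowering Q S)
    (motive := fun m => ∃ s ∈ S, ∃ K, aeval (height Q) (lowerPoly μ K) • (m - s) = 0)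
    (span_le_iSup_lowering hI hX hm) (fun k x hx => ?_) ?_ ?_
  · cases k with
    | zero => exact ⟨x, hx, 0, by simp⟩
    | succ k =>
      refine ⟨0, zero_mem _, k + 1, ?_⟩
      rw [sub_zero, aeval_smul_of_smul_eq (height_smul_lowering hμ _ x hx),
        (eval_lowerPoly_eq_zero_iff _ _ _).2 ⟨k, k.lt_succ_self, by push_cast; rfl⟩, zero_smul]
  · exact ⟨0, zero_mem _, 0, by simp⟩
  · rintro x y ⟨s, hs, K, hK⟩ ⟨s', hs', K', hK'⟩
    refine ⟨s + s', add_mem hs hs', max K K', ?_⟩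
    obtain ⟨p, hp⟩ := lowerPoly_dvd μ (le_max_left K K')
    obtain ⟨q, hq⟩ := lowerPoly_dvd μ (le_max_right K K')
    rw [add_sub_add_comm, smul_add]
    nth_rewrite 1 [hp]
    rw [hq, mul_comm _ p, mul_comm _ q, map_mul, map_mul, mul_smul, mul_smul, hK, hK', smul_zero,
      smul_zero, add_zero]

/-- `v` is a highest weight vector of weight `w`; it may be zero and need not generate. -/
def IsHighestWeightVector (Q : Fin n → ℂ) {M : Type*} [AddCommGroup M] [Module ℂ M] [Module (U Q) M]
    (w : Fin (n + 1) → ℕ → ℂ) (v : M) : Prop :=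
  (∀ i t, Xp Q i t • v = 0) ∧ ∀ j t, I Q j t • v = w j t • v

/-- The eigenvalue of the grading element on a highest weight vector of weight `w`. -/
def weightHeight (w : Fin (n + 1) → ℕ → ℂ) : ℂ := ∑ j : Fin (n + 1), (-(j : ℕ) : ℂ) * w j 0

namespace IsHighestWeightVector

variable {w w' : Fin (n + 1) → ℕ → ℂ} {v v' : M}

theorem height_smul (hv : IsHighestWeightVector Q w v) : height Q • v = weightHeight w • v := by
  simp only [height, weightHeight, Finset.sum_smul, smul_assoc, hv.2, smul_smul]

theorem exists_lowerPoly_smul_eq_zero (hv : IsHighestWeightVector Q w v)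
    (hspan : Submodule.span (U Q) {v} = ⊤) (m : M) :
    ∃ c : ℂ, ∃ K, aeval (height Q) (lowerPoly (weightHeight w) K) • (m - c • v) = 0 := by
  have hmem : m ∈ Submodule.span (U Q) (Submodule.span ℂ {v} : Set M) :=
    (Submodule.span_mono Submodule.subset_span :
      Submodule.span (U Q) {v} ≤ Submodule.span (U Q) (Submodule.span ℂ {v} : Set M))
      (hspan ▸ Submodule.mem_top)
  have hI : ∀ j t, ∀ m ∈ Submodule.span ℂ {v}, I Q j t • m ∈ Submodule.span ℂ {v} := by
    intro j t m hm
    obtain ⟨c, rfl⟩ := Submodule.mem_span_singleton.1 hm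
    rw [smul_comm_complex, hv.2, smul_smul]
    exact Submodule.mem_span_singleton.2 ⟨_, rfl⟩
  have hX : ∀ i t, ∀ m ∈ Submodule.span ℂ {v}, Xp Q i t • m = 0 := by
    intro i t m hm
    obtain ⟨c, rfl⟩ := Submodule.mem_span_singleton.1 hm
    rw [smul_comm_complex, hv.1, smul_zero]
  have hμ : ∀ m ∈ Submodule.span ℂ {v}, height Q • m = weightHeight w • m := by
    intro m hm
    obtain ⟨c, rfl⟩ := Submodule.mem_span_singleton.1 hm
    rw [smul_comm_complex, hv.height_smul, smul_comm]
  obtain ⟨s, hs, K, hK⟩ := DeformedCurrent.exists_lowerPoly_smul_eq_zero hI hX hμ hmem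
  obtain ⟨c, rfl⟩ := Submodule.mem_span_singleton.1 hs
  exact ⟨c, K, hK⟩

theorem aeval_height_smul (hv : IsHighestWeightVector Q w v) (p : ℂ[X]) :
    aeval (height Q) p • v = p.eval (weightHeight w) • v :=
  aeval_smul_of_smul_eq hv.height_smul p

theorem lowerPoly_eval_ne_zero (w : Fin (n + 1) → ℕ → ℂ) (K : ℕ) :
    (lowerPoly (weightHeight w) K).eval (weightHeight w) ≠ 0 := by
  simpa using eval_lowerPoly_ne_zero (weightHeight w) 0 K

/-- A proper submodule of a highest weight module has no component along the highest weight
vector: applying `lowerPoly` to `c v + (lower terms)` isolates a nonzero multiple of `c v`. -/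
theorem lowerPoly_smul_of_mem (hv : IsHighestWeightVector Q w v)
    (hspan : Submodule.span (U Q) {v} = ⊤) {N : Submodule (U Q) M} (hN : N ≠ ⊤) {m : M}
    (hm : m ∈ N) : ∃ K, aeval (height Q) (lowerPoly (weightHeight w) K) • m = 0 := by
  obtain ⟨c, K, hK⟩ := hv.exists_lowerPoly_smul_eq_zero hspan m
  rw [smul_sub, sub_eq_zero, smul_comm_complex, hv.aeval_height_smul, smul_smul] at hK
  have hc : c = 0 := by
    by_contra hc
    refine hN (top_le_iff.1 (hspan ▸ (Submodule.span_singleton_le_iff_mem _ _).2 ?_))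
    have h := N.smul_mem (algebraMap ℂ (U Q)
      (c * (lowerPoly (weightHeight w) K).eval (weightHeight w))⁻¹)
      (hK ▸ N.smul_mem _ hm :
        (c * (lowerPoly (weightHeight w) K).eval (weightHeight w)) • v ∈ N)
    rwa [algebraMap_smul, smul_smul, inv_mul_cancel₀ (mul_ne_zero hc (lowerPoly_eval_ne_zero w K)),
      one_smul] at h
  exact ⟨K, by rw [hK, hc, zero_mul, zero_smul]⟩

/-- The sum of the proper submodules of a nonzero highest weight module is proper. -/
theorem sSup_ne_top (hv : IsHighestWeightVector Q w v)
    (hspan : Submodule.span (U Q) {v} = ⊤) (h0 : v ≠ 0) :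
    sSup {N : Submodule (U Q) M | N ≠ ⊤} ≠ ⊤ := by
  intro htop
  have hmem : v ∈ ⨆ N : {N : Submodule (U Q) M // N ≠ ⊤}, N.1 := by
    rw [sSup_eq_iSup'] at htop
    exact (htop.symm ▸ Submodule.mem_top :)
  obtain ⟨K, hK⟩ := Submodule.iSup_induction
    (fun N : {N : Submodule (U Q) M // N ≠ ⊤} => N.1)
    (motive := fun m => ∃ K, aeval (height Q) (lowerPoly (weightHeight w) K) • m = 0) hmem
    (fun N m hm => hv.lowerPoly_smul_of_mem hspan N.2 hm) ⟨0, smul_zero _⟩ (by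
      rintro x y ⟨K, hK⟩ ⟨K', hK'⟩
      refine ⟨max K K', ?_⟩
      obtain ⟨p, hp⟩ := lowerPoly_dvd (weightHeight w) (le_max_left K K')
      obtain ⟨q, hq⟩ := lowerPoly_dvd (weightHeight w) (le_max_right K K')
      rw [smul_add]
      nth_rewrite 1 [hp]
      rw [hq, mul_comm _ p, mul_comm _ q, map_mul, map_mul, mul_smul, mul_smul, hK, hK', smul_zero,
        smul_zero, add_zero])
  rw [hv.aeval_height_smul] at hK
  exact (smul_ne_zero (lowerPoly_eval_ne_zero w K) h0) hK

theorem eq_of_smul (hv : IsHighestWeightVector Q w v) (hv' : IsHighestWeightVector Q w' v')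
    (h0 : v' ≠ 0) {c : ℂ} (h : v' = c • v) : w' = w := by
  funext j t
  have h1 := hv'.2 j t
  rw [h, smul_comm_complex, hv.2, smul_comm, ← h] at h1
  exact (smul_left_injective ℂ h0 h1).symm

/-- A highest weight vector is proportional to the generating one, unless it sits strictly
lower. -/
theorem eq_or_exists (hv : IsHighestWeightVector Q w v) (hspan : Submodule.span (U Q) {v} = ⊤)
    (hv' : IsHighestWeightVector Q w' v') (h0 : v' ≠ 0) :
    w' = w ∨ ∃ k : ℕ, weightHeight w' = weightHeight w - (k + 1) := by
  obtain ⟨c, K, hK⟩ := hv.exists_lowerPoly_smul_eq_zero hspan v'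
  rw [smul_sub, sub_eq_zero, smul_comm_complex, hv.aeval_height_smul,
    hv'.aeval_height_smul, smul_smul] at hK
  by_cases h : (lowerPoly (weightHeight w) K).eval (weightHeight w') = 0
  · obtain ⟨k, -, hk⟩ := (eval_lowerPoly_eq_zero_iff _ _ _).1 h
    exact Or.inr ⟨k, hk⟩
  · refine Or.inl (hv.eq_of_smul hv' h0
      (c := ((lowerPoly (weightHeight w) K).eval (weightHeight w'))⁻¹ *
        (c * (lowerPoly (weightHeight w) K).eval (weightHeight w))) ?_)
    rw [mul_smul, ← hK, smul_smul, inv_mul_cancel₀ h, one_smul]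

/-- The highest weight of a simple module is unique. -/
theorem weight_unique [IsSimpleModule (U Q) M] (hv : IsHighestWeightVector Q w v) (h0 : v ≠ 0)
    (hv' : IsHighestWeightVector Q w' v') (h0' : v' ≠ 0) : w' = w := by
  rcases hv.eq_or_exists (IsSimpleModule.span_singleton_eq_top _ h0) hv' h0' with h | ⟨k, hk⟩
  · exact h
  rcases hv'.eq_or_exists (IsSimpleModule.span_singleton_eq_top _ h0') hv h0 with h | ⟨l, hl⟩
  · exact h.symm
  exfalso
  have : ((k + l + 2 : ℕ) : ℂ) = 0 := by push_cast; linear_combination hk + hl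
  exact absurd (Nat.cast_eq_zero.1 this) (by omega)

/-- A simple highest weight module has no singular vectors one step below the top, since they would
generate a submodule that lies strictly below the highest weight vector. -/
theorem eq_zero_of_singular [IsSimpleModule (U Q) M] (hv : IsHighestWeightVector Q w v)
    (h0 : v ≠ 0) {S : Submodule ℂ M} (hI : ∀ j t, ∀ m ∈ S, I Q j t • m ∈ S)
    (hX : ∀ i t, ∀ m ∈ S, Xp Q i t • m = 0)
    (hμ : ∀ m ∈ S, height Q • m = (weightHeight w - 1) • m) {m : M} (hm : m ∈ S) : m = 0 := by
  by_contra hm0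
  have hspan : v ∈ Submodule.span (U Q) (S : Set M) := by
    have h1 : Submodule.span (U Q) {m} ≤ Submodule.span (U Q) (S : Set M) :=
      Submodule.span_mono (Set.singleton_subset_iff.2 hm)
    rw [IsSimpleModule.span_singleton_eq_top _ hm0] at h1
    exact h1 Submodule.mem_top
  obtain ⟨s, hs, K, hK⟩ := DeformedCurrent.exists_lowerPoly_smul_eq_zero hI hX hμ hspan
  rw [smul_sub, sub_eq_zero, hv.aeval_height_smul] at hK
  have hne := eval_lowerPoly_ne_zero (weightHeight w - 1) 1 K
  rw [Nat.cast_one, sub_add_cancel] at hne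
  have hvS : v ∈ S := by
    rw [← inv_smul_smul₀ hne v, hK, aeval_smul_of_smul_eq (hμ s hs)]
    exact S.smul_mem _ (S.smul_mem _ hs)
  have h1 := hμ v hvS
  rw [hv.height_smul, sub_smul, one_smul] at h1
  exact h0 (sub_eq_self.1 h1.symm)

end IsHighestWeightVector

/-- The canonical generator of the Verma module. -/
def vermaVector (Q : Fin n → ℂ) (w : Fin (n + 1) → ℕ → ℂ) : Verma Q w :=
  Submodule.Quotient.mk 1

theorem smul_vermaVector (w : Fin (n + 1) → ℕ → ℂ) (x : U Q) :
    x • vermaVector Q w = Submodule.Quotient.mk x := by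
  rw [vermaVector, ← Submodule.Quotient.mk_smul, smul_eq_mul, mul_one]

theorem isHighestWeightVector_vermaVector (w : Fin (n + 1) → ℕ → ℂ) :
    IsHighestWeightVector Q w (vermaVector Q w) := by
  refine ⟨fun i t => ?_, fun j t => ?_⟩
  · rw [smul_vermaVector, Submodule.Quotient.mk_eq_zero]
    exact Submodule.subset_span (Or.inl ⟨i, t, rfl⟩)
  · rw [← algebraMap_smul (U Q) (w j t), ← sub_eq_zero, ← sub_smul, smul_vermaVector,
      Submodule.Quotient.mk_eq_zero]
    exact Submodule.subset_span (Or.inr ⟨j, t, rfl⟩)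

theorem span_vermaVector (w : Fin (n + 1) → ℕ → ℂ) :
    Submodule.span (U Q) {vermaVector Q w} = ⊤ := by
  refine eq_top_iff.2 fun m _ => ?_
  obtain ⟨x, rfl⟩ := Submodule.Quotient.mk_surjective _ m
  exact Submodule.mem_span_singleton.2 ⟨x, smul_vermaVector w x⟩

/-- The universal property of the Verma module. -/
theorem exists_verma_hom {w : Fin (n + 1) → ℕ → ℂ} {v : M} (hv : IsHighestWeightVector Q w v) :
    ∃ f : Verma Q w →ₗ[U Q] M, f (vermaVector Q w) = v := by
  refine ⟨(vermaIdeal Q w).liftQ (LinearMap.toSpanSingleton (U Q) M v) ?_, ?_⟩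
  · refine Submodule.span_le.2 ?_
    rintro x (⟨i, t, rfl⟩ | ⟨j, t, rfl⟩)
    · simpa using hv.1 i t
    · simp [sub_smul, hv.2 j t]
  · exact one_smul _ v

section Quotient

variable {w : Fin (n + 1) → ℕ → ℂ} {v : M}

theorem isCoatom_vermaRad (hv : IsHighestWeightVector Q w v) (h0 : v ≠ 0) :
    IsCoatom (vermaRad Q w) := by
  obtain ⟨f, hf⟩ := exists_verma_hom hv
  refine ⟨(isHighestWeightVector_vermaVector w).sSup_ne_top (span_vermaVector w) ?_, ?_⟩
  · rintro h
    rw [h, map_zero] at hf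
    exact h0 hf.symm
  · intro N hN
    by_contra hne
    exact absurd (le_sSup hne) (not_le_of_gt hN)

theorem isSimpleModule_L (hv : IsHighestWeightVector Q w v) (h0 : v ≠ 0) :
    IsSimpleModule (U Q) (L Q w) :=
  isSimpleModule_iff_isCoatom.2 (isCoatom_vermaRad hv h0)

theorem isHighestWeightVector_mk (w : Fin (n + 1) → ℕ → ℂ) :
    IsHighestWeightVector Q w (Submodule.Quotient.mk (vermaVector Q w) : L Q w) := by
  have h := isHighestWeightVector_vermaVector (Q := Q) w
  refine ⟨fun i t => ?_, fun j t => ?_⟩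
  · rw [← Submodule.Quotient.mk_smul, h.1, Submodule.Quotient.mk_zero]
  · rw [← Submodule.Quotient.mk_smul, h.2]
    rfl

theorem span_mk_vermaVector (w : Fin (n + 1) → ℕ → ℂ) :
    Submodule.span (U Q) {(Submodule.Quotient.mk (vermaVector Q w) : L Q w)} = ⊤ := by
  have h := Submodule.map_span (vermaRad Q w).mkQ {vermaVector Q w}
  rw [span_vermaVector, Submodule.map_top, Submodule.range_mkQ, Set.image_singleton] at h
  exact h.symm

theorem isHighestWeightModule_L (w : Fin (n + 1) → ℕ → ℂ) : IsHighestWeightModule Q w (L Q w) :=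
  ⟨_, span_mk_vermaVector w, isHighestWeightVector_mk w⟩

theorem ker_le_vermaRad {M : Type*} [AddCommGroup M] [Module (U Q) M] {v : M} (h0 : v ≠ 0)
    {f : Verma Q w →ₗ[U Q] M} (hf : f (vermaVector Q w) = v) :
    LinearMap.ker f ≤ vermaRad Q w := by
  refine le_sSup fun htop => h0 ?_
  rw [← hf]
  exact LinearMap.mem_ker.1 (htop ▸ Submodule.mem_top)

theorem finite_quotient_of_ker_le {A V W : Type*} [Ring A] [Algebra ℂ A] [AddCommGroup V]
    [Module ℂ V] [Module A V] [IsScalarTower ℂ A V] [AddCommGroup W] [Module ℂ W] [Module A W]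
    [IsScalarTower ℂ A W] [FiniteDimensional ℂ W] (f : V →ₗ[A] W) {N : Submodule A V}
    (h : LinearMap.ker f ≤ N) : Module.Finite ℂ (V ⧸ N) := by
  have hinj : Function.Injective ((LinearMap.ker f).liftQ f le_rfl) :=
    LinearMap.ker_eq_bot.1 (Submodule.ker_liftQ_eq_bot' _ _ rfl)
  have hfin : Module.Finite ℂ (V ⧸ LinearMap.ker f) :=
    Module.Finite.of_injective (((LinearMap.ker f).liftQ f le_rfl).restrictScalars ℂ) hinj
  have hs : Function.Surjective (Submodule.factor h) := Submodule.factor_surjective _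
  exact Module.Finite.of_surjective ((Submodule.factor h).restrictScalars ℂ) hs

theorem finiteDimensional_L [FiniteDimensional ℂ M] (hv : IsHighestWeightVector Q w v)
    (h0 : v ≠ 0) : FiniteDimensional ℂ (L Q w) := by
  obtain ⟨f, hf⟩ := exists_verma_hom hv
  exact finite_quotient_of_ker_le f (ker_le_vermaRad h0 hf)

theorem nonempty_equiv_L [IsSimpleModule (U Q) M] (hv : IsHighestWeightVector Q w v)
    (h0 : v ≠ 0) : Nonempty (M ≃ₗ[U Q] L Q w) := by
  obtain ⟨f, hf⟩ := exists_verma_hom hv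
  have hf0 : f ≠ 0 := by
    rintro rfl
    exact h0 hf.symm
  have hsurj : Function.Surjective f := LinearMap.surjective_of_ne_zero hf0
  have hco : IsCoatom (LinearMap.ker f) := LinearMap.isCoatom_ker_of_surjective hsurj
  have heq : LinearMap.ker f = vermaRad Q w :=
    ((hco.le_iff.1 (ker_le_vermaRad h0 hf)).resolve_left (isCoatom_vermaRad hv h0).1).symm
  exact ⟨(f.quotKerEquivOfSurjective hsurj).symm.trans (Submodule.quotEquivOfEq _ _ heq)⟩

end Quotient

end Module

/-! ### Rank one operators and highest weight vectors -/

/-- The linear map `ℂ[X] → A` with `X ^ t ↦ F t`. -/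
def polyMap {A : Type*} [AddCommGroup A] [Module ℂ A] (F : ℕ → A) : ℂ[X] →ₗ[ℂ] A :=
  Polynomial.lsum fun t => LinearMap.toSpanSingleton ℂ A (F t)

theorem polyMap_monomial {A : Type*} [AddCommGroup A] [Module ℂ A] (F : ℕ → A) (t : ℕ) (c : ℂ) :
    polyMap F (monomial t c) = c • F t := by
  simp [polyMap, Polynomial.lsum_apply, sum_monomial_index]

theorem polyMap_X_pow {A : Type*} [AddCommGroup A] [Module ℂ A] (F : ℕ → A) (t : ℕ) :
    polyMap F (X ^ t) = F t := by
  rw [← monomial_one_right_eq_X_pow, polyMap_monomial, one_smul]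

/-- `X⁺_i ⊗ b`, i.e. `∑_t b_t X⁺_{i,t}`. -/
def XpPoly (Q : Fin n → ℂ) (i : Fin n) : ℂ[X] →ₗ[ℂ] U Q := polyMap (Xp Q i)

/-- `X⁻_i ⊗ b`, i.e. `∑_t b_t X⁻_{i,t}`. -/
def XmPoly (Q : Fin n → ℂ) (i : Fin n) : ℂ[X] →ₗ[ℂ] U Q := polyMap (Xm Q i)

/-- `J_i ⊗ b`, i.e. `∑_t b_t J_{i,t}`. -/
def JPoly (Q : Fin n → ℂ) (i : Fin n) : ℂ[X] →ₗ[ℂ] U Q := polyMap (J Q i)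

theorem XmPoly_mul_XmPoly (i : Fin n) (a b : ℂ[X]) :
    XmPoly Q i a * XmPoly Q i b = XmPoly Q i b * XmPoly Q i a := by
  induction a using Polynomial.induction_on' with
  | add a a' ha ha' => rw [map_add, add_mul, mul_add, ha, ha']
  | monomial s c =>
    induction b using Polynomial.induction_on' with
    | add b b' hb hb' => rw [map_add, add_mul, mul_add, hb, hb']
    | monomial t d =>
      simp only [XmPoly, polyMap_monomial, smul_mul_smul_comm, Xm_mul_Xm_same i s t, mul_comm c d]

theorem XpPoly_mul_XmPoly (i : Fin n) (a b : ℂ[X]) :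
    XpPoly Q i a * XmPoly Q i b =
      XmPoly Q i b * XpPoly Q i a + JPoly Q i ((1 - C (Q i) * X) * (a * b)) := by
  induction a using Polynomial.induction_on' with
  | add a a' ha ha' =>
    rw [map_add, add_mul, mul_add, ha, ha', add_mul, mul_add, map_add]
    abel
  | monomial s c =>
    induction b using Polynomial.induction_on' with
    | add b b' hb hb' =>
      rw [map_add, add_mul, mul_add, hb, hb', mul_add, mul_add, map_add]
      abel
    | monomial t d =>
      have h : (1 - C (Q i) * X) * (monomial s c * monomial t d) =
          monomial (t + s) (c * d) - monomial (t + s + 1) (c * d * Q i) := by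
        rw [monomial_mul_monomial, sub_mul, one_mul, mul_assoc, X_mul_monomial, C_mul_monomial,
          add_comm s t, mul_comm (Q i)]
      rw [h, map_sub]
      simp only [XpPoly, XmPoly, JPoly, polyMap_monomial, smul_mul_smul_comm, Xp_mul_Xm_same,
        smul_add, smul_sub, smul_smul, mul_comm c d]

theorem JPoly_mul_XmPoly (i : Fin n) (a b : ℂ[X]) :
    JPoly Q i a * XmPoly Q i b =
      XmPoly Q i b * JPoly Q i a - (2 : ℂ) • XmPoly Q i (a * b) := by
  induction a using Polynomial.induction_on' with
  | add a a' ha ha' =>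
    rw [map_add, add_mul, mul_add, ha, ha', add_mul, map_add, smul_add]
    abel
  | monomial s c =>
    induction b using Polynomial.induction_on' with
    | add b b' hb hb' =>
      rw [map_add, add_mul, mul_add, hb, hb', mul_add, map_add, smul_add]
      abel
    | monomial t d =>
      simp only [XmPoly, JPoly, monomial_mul_monomial, polyMap_monomial, smul_mul_smul_comm,
        J_mul_Xm, smul_sub, smul_smul, mul_comm c d, mul_comm (2 : ℂ)]

theorem I_mul_XmPoly (j : Fin (n + 1)) (i : Fin n) (s : ℕ) (b : ℂ[X]) :
    I Q j s * XmPoly Q i b =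
      XmPoly Q i b * I Q j s - aCoeff j i • XmPoly Q i (X ^ s * b) := by
  induction b using Polynomial.induction_on' with
  | add b b' hb hb' =>
    rw [map_add, add_mul, mul_add, hb, hb', mul_add, map_add, smul_add]
    abel
  | monomial t d =>
    rw [← monomial_one_right_eq_X_pow, monomial_mul_monomial]
    simp only [XmPoly, polyMap_monomial, mul_smul_comm, smul_mul_assoc, I_mul_Xm, smul_sub,
      smul_smul, one_mul, mul_comm d]

theorem Xp_mul_XmPoly_ne {i j : Fin n} (hij : j ≠ i) (t : ℕ) (b : ℂ[X]) :
    Xp Q j t * XmPoly Q i b = XmPoly Q i b * Xp Q j t := by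
  induction b using Polynomial.induction_on' with
  | add b b' hb hb' => rw [map_add, add_mul, mul_add, hb, hb']
  | monomial s d =>
    simp only [XmPoly, polyMap_monomial, mul_smul_comm, smul_mul_assoc, Xp_mul_Xm_ne hij]

theorem height_mul_XmPoly (i : Fin n) (b : ℂ[X]) :
    height Q * XmPoly Q i b = XmPoly Q i b * height Q - XmPoly Q i b := by
  induction b using Polynomial.induction_on' with
  | add b b' hb hb' =>
    rw [map_add, add_mul, mul_add, hb, hb']
    abel
  | monomial s d =>
    simp only [XmPoly, polyMap_monomial, mul_smul_comm, smul_mul_assoc, height_mul_Xm, smul_sub]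

section Module

variable {M : Type*} [AddCommGroup M] [Module ℂ M] [Module (U Q) M] [IsScalarTower ℂ (U Q) M]

/-- The functional `X ^ t ↦ w_{i,t} - w_{i+1,t}` attached to a weight and a node. -/
def nodeFunctional (w : Fin (n + 1) → ℕ → ℂ) (i : Fin n) : ℂ[X] →ₗ[ℂ] ℂ :=
  polyMap fun t => w i.castSucc t - w i.succ t

namespace IsHighestWeightVector

variable {w : Fin (n + 1) → ℕ → ℂ} {v : M}

theorem XpPoly_smul (hv : IsHighestWeightVector Q w v) (i : Fin n) (a : ℂ[X]) :
    XpPoly Q i a • v = 0 := by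
  induction a using Polynomial.induction_on' with
  | add a a' ha ha' => rw [map_add, add_smul, ha, ha', add_zero]
  | monomial s c => rw [XpPoly, polyMap_monomial, smul_assoc, hv.1, smul_zero]

theorem JPoly_smul (hv : IsHighestWeightVector Q w v) (i : Fin n) (a : ℂ[X]) :
    JPoly Q i a • v = nodeFunctional w i a • v := by
  induction a using Polynomial.induction_on' with
  | add a a' ha ha' => rw [map_add, add_smul, ha, ha', map_add, add_smul]
  | monomial s c =>
    rw [JPoly, polyMap_monomial, smul_assoc, J, sub_smul, hv.2, hv.2, nodeFunctional,
      polyMap_monomial, smul_assoc, sub_smul]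

/-- The polynomials `b` for which `X⁻_i ⊗ b` kills a highest weight vector form an ideal. -/
def annIdeal (hv : IsHighestWeightVector Q w v) (i : Fin n) : Ideal ℂ[X] where
  carrier := {b | XmPoly Q i b • v = 0}
  zero_mem' := by rw [Set.mem_ofPred_eq, map_zero, zero_smul]
  add_mem' {a b} ha hb := by
    rw [Set.mem_ofPred_eq] at *
    rw [map_add, add_smul, ha, hb, add_zero]
  smul_mem' p b hb := by
    rw [Set.mem_ofPred_eq] at *
    have h := congrArg (· • v) (JPoly_mul_XmPoly (Q := Q) i p b)
    simp only [sub_smul, mul_smul, hv.JPoly_smul, smul_comm_complex, hb, smul_zero, zero_sub,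
      smul_assoc] at h
    rw [smul_eq_mul]
    exact (smul_eq_zero.1 (neg_eq_zero.1 h.symm)).resolve_left two_ne_zero

theorem mem_annIdeal (hv : IsHighestWeightVector Q w v) {i : Fin n} {b : ℂ[X]} :
    b ∈ hv.annIdeal i ↔ XmPoly Q i b • v = 0 := Iff.rfl

theorem XpPoly_smul_XmPoly_smul (hv : IsHighestWeightVector Q w v) (i : Fin n) (a b : ℂ[X]) :
    XpPoly Q i a • XmPoly Q i b • v =
      nodeFunctional w i ((1 - C (Q i) * X) * (a * b)) • v := by
  rw [← mul_smul, XpPoly_mul_XmPoly, add_smul, mul_smul, hv.XpPoly_smul, smul_zero, zero_add,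
    hv.JPoly_smul]

/-- In a simple highest weight module, `(X⁻_i ⊗ b) v` vanishes as soon as it is singular for the
node `i`: the generators `X⁺_j` of the other nodes commute with `X⁻_i` and kill it anyway. -/
theorem mem_annIdeal_iff [IsSimpleModule (U Q) M] (hv : IsHighestWeightVector Q w v) (h0 : v ≠ 0)
    (i : Fin n) (b : ℂ[X]) :
    b ∈ hv.annIdeal i ↔ ∀ a, nodeFunctional w i ((1 - C (Q i) * X) * (a * b)) = 0 := by
  refine ⟨fun hb a => ?_, fun hb => ?_⟩
  · have h := hv.XpPoly_smul_XmPoly_smul i a b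
    rw [hv.mem_annIdeal.1 hb, smul_zero] at h
    exact (smul_eq_zero.1 h.symm).resolve_right h0
  -- the vectors `(X⁻_i ⊗ b) v` with `b` as on the right form a space of singular vectors stable
  -- under the `I_{j,t}`, one step below the top
  · let B : Submodule ℂ ℂ[X] :=
      { carrier := {b | ∀ a, nodeFunctional w i ((1 - C (Q i) * X) * (a * b)) = 0}
        zero_mem' := fun a => by rw [mul_zero, mul_zero, map_zero]
        add_mem' := fun {b b'} hb hb' a => by rw [mul_add, mul_add, map_add, hb, hb', add_zero]
        smul_mem' := fun c b hb a => by
          rw [mul_smul_comm, mul_smul_comm, map_smul, hb, smul_zero] }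
    let F : ℂ[X] →ₗ[ℂ] M :=
      { toFun := fun b => XmPoly Q i b • v
        map_add' := fun b b' => by rw [map_add, add_smul]
        map_smul' := fun c b => by rw [map_smul, smul_assoc, RingHom.id_apply] }
    refine hv.eq_zero_of_singular h0 (S := B.map F) ?_ ?_ ?_ (Submodule.mem_map_of_mem hb)
    · rintro j t _ ⟨b, hb, rfl⟩
      change I Q j t • XmPoly Q i b • v ∈ _
      rw [← mul_smul, I_mul_XmPoly, sub_smul, mul_smul, hv.2, smul_comm_complex, smul_assoc]
      refine sub_mem (Submodule.smul_mem _ _ (Submodule.mem_map_of_mem hb))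
        (Submodule.smul_mem _ _ (Submodule.mem_map_of_mem (f := F) (r := X ^ t * b) fun a => ?_))
      rw [← mul_assoc a]
      exact hb _
    · rintro j t _ ⟨b, hb, rfl⟩
      change Xp Q j t • XmPoly Q i b • v = 0
      by_cases hij : j = i
      · subst hij
        have h := hv.XpPoly_smul_XmPoly_smul j (X ^ t) b
        rwa [hb, zero_smul, XpPoly, polyMap_X_pow] at h
      · rw [← mul_smul, Xp_mul_XmPoly_ne hij, mul_smul, hv.1, smul_zero]
    · rintro _ ⟨b, hb, rfl⟩
      change height Q • XmPoly Q i b • v = _ • XmPoly Q i b • v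
      rw [← mul_smul, height_mul_XmPoly, sub_smul, mul_smul, hv.height_smul, smul_comm_complex,
        sub_smul, one_smul]

theorem height_smul_pow (hv : IsHighestWeightVector Q w v) (i : Fin n) (b : ℂ[X]) (k : ℕ) :
    height Q • XmPoly Q i b ^ k • v = (weightHeight w - k) • XmPoly Q i b ^ k • v := by
  induction k with
  | zero => rw [pow_zero, one_smul, hv.height_smul, Nat.cast_zero, sub_zero]
  | succ k ih =>
    rw [pow_succ', mul_smul, ← mul_smul (height Q), height_mul_XmPoly, sub_smul, mul_smul, ih,
      smul_comm_complex]
    generalize XmPoly Q i b • XmPoly Q i b ^ k • v = x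
    push_cast
    module

/-- Lowering operators act nilpotently on a highest weight vector of a finite dimensional
module. -/
theorem exists_pow_smul_eq_zero [FiniteDimensional ℂ M] (hv : IsHighestWeightVector Q w v)
    (i : Fin n) (b : ℂ[X]) : ∃ k, XmPoly Q i b ^ k • v = 0 := by
  by_contra! hne
  let H : Module.End ℂ M := Algebra.lsmul ℂ ℂ M (height Q)
  have hH : ∀ k : ℕ, weightHeight w - k ∈ {μ | H.HasEigenvalue μ} := fun k =>
    Module.End.hasEigenvalue_of_hasEigenvector
      (Module.End.hasEigenvector_iff.2
        ⟨Module.End.mem_eigenspace_iff.2 (hv.height_smul_pow i b k), hne k⟩)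
  exact Set.infinite_of_injective_forall_mem
    (fun k l h => by simpa using h) hH H.finite_hasEigenvalue

section Sl2

variable {i : Fin n} {a b : ℂ[X]} {c : ℂ}

theorem JPoly_smul_pow (hv : IsHighestWeightVector Q w v) {g : ℂ[X]}
    (h : XmPoly Q i (g * b) • v = c • XmPoly Q i b • v) (k : ℕ) :
    JPoly Q i g • XmPoly Q i b ^ k • v =
      (nodeFunctional w i g - 2 * k * c) • XmPoly Q i b ^ k • v := by
  induction k with
  | zero => rw [pow_zero, one_smul, hv.JPoly_smul, Nat.cast_zero, mul_zero, zero_mul, sub_zero]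
  | succ k ih =>
    have hc : Commute (XmPoly Q i (g * b)) (XmPoly Q i b ^ k) :=
      Commute.pow_right (XmPoly_mul_XmPoly i _ _) k
    rw [pow_succ', mul_smul, ← mul_smul (JPoly Q i g), JPoly_mul_XmPoly, sub_smul, mul_smul, ih,
      smul_comm_complex, smul_assoc, ← mul_smul (XmPoly Q i (g * b)), hc.eq, mul_smul, h,
      smul_comm_complex, ← mul_smul (XmPoly Q i b ^ k), ← pow_succ, pow_succ', mul_smul]
    generalize XmPoly Q i b • XmPoly Q i b ^ k • v = x
    push_cast
    module

theorem XpPoly_smul_pow_succ (hv : IsHighestWeightVector Q w v)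
    (h : XmPoly Q i ((1 - C (Q i) * X) * (a * b) * b) • v = c • XmPoly Q i b • v) (k : ℕ) :
    XpPoly Q i a • XmPoly Q i b ^ (k + 1) • v =
      ((k + 1) * (nodeFunctional w i ((1 - C (Q i) * X) * (a * b)) - k * c)) •
        XmPoly Q i b ^ k • v := by
  induction k with
  | zero =>
    rw [zero_add, pow_one, hv.XpPoly_smul_XmPoly_smul, pow_zero, one_smul]
    congr 1
    push_cast
    ring
  | succ k ih =>
    rw [pow_succ', mul_smul, ← mul_smul (XpPoly Q i a), XpPoly_mul_XmPoly, add_smul, mul_smul, ih,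
      hv.JPoly_smul_pow h, smul_comm_complex, ← mul_smul (XmPoly Q i b), ← pow_succ', ← add_smul]
    congr 1
    push_cast
    ring

/-- A rank one computation: if the span of `X⁺_i ⊗ a`, `X⁻_i ⊗ b` and their commutator
`J_i ⊗ g` acts like a (possibly degenerate) `sl₂`-triple, then the eigenvalue of `J_i ⊗ g` on the
highest weight vector is integral. -/
theorem exists_nat_nodeFunctional_eq [FiniteDimensional ℂ M] (hv : IsHighestWeightVector Q w v)
    (h0 : v ≠ 0)
    (h : XmPoly Q i ((1 - C (Q i) * X) * (a * b) * b) • v = c • XmPoly Q i b • v) :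
    ∃ k : ℕ, nodeFunctional w i ((1 - C (Q i) * X) * (a * b)) = k * c := by
  classical
  have hex := hv.exists_pow_smul_eq_zero i b
  obtain ⟨k, hk⟩ : ∃ k, Nat.find hex = k + 1 := by
    refine Nat.exists_eq_succ_of_ne_zero fun hz => h0 ?_
    simpa [hz] using Nat.find_spec hex
  have h1 := hv.XpPoly_smul_pow_succ h k
  have h2 : XmPoly Q i b ^ (k + 1) • v = 0 := hk ▸ Nat.find_spec hex
  rw [h2, smul_zero] at h1
  have h3 : XmPoly Q i b ^ k • v ≠ 0 := Nat.find_min hex (by omega)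
  have h4 := (smul_eq_zero.1 h1.symm).resolve_right h3
  exact ⟨k, sub_eq_zero.1 ((mul_eq_zero.1 h4).resolve_left (Nat.cast_add_one_ne_zero k))⟩

end Sl2

theorem annIdeal_ne_bot [FiniteDimensional ℂ M] (hv : IsHighestWeightVector Q w v) (i : Fin n) :
    hv.annIdeal i ≠ ⊥ := by
  intro hbot
  let F : ℂ[X] →ₗ[ℂ] M :=
    { toFun := fun b => XmPoly Q i b • v
      map_add' := fun b b' => by rw [map_add, add_smul]
      map_smul' := fun c b => by rw [map_smul, smul_assoc, RingHom.id_apply] }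
  have hF : Function.Injective F := (injective_iff_map_eq_zero F).2 fun b hb =>
    (Submodule.mem_bot ℂ[X]).1 (hbot ▸ (hv.mem_annIdeal.2 hb))
  have hfin : Module.Finite ℂ ℂ[X] := Module.Finite.of_injective F hF
  exact Polynomial.not_finite hfin

end IsHighestWeightVector

/-- Every nonzero finite dimensional module contains a nonzero highest weight vector. -/
theorem exists_isHighestWeightVector [FiniteDimensional ℂ M] [Nontrivial M] :
    ∃ (w : Fin (n + 1) → ℕ → ℂ) (v : M), v ≠ 0 ∧ IsHighestWeightVector Q w v := by
  -- a minimal nonzero space of singular vectors stable under the `I_{j,t}`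
  let P : Submodule ℂ M → Prop := fun S =>
    S ≠ ⊥ ∧ (∀ j t, ∀ m ∈ S, I Q j t • m ∈ S) ∧ ∀ i t, ∀ m ∈ S, Xp Q i t • m = 0
  have hex : ∃ S, P S := by
    let H : Module.End ℂ M := Algebra.lsmul ℂ ℂ M (height Q)
    obtain ⟨μ, hμ⟩ := Module.End.exists_eigenvalue H
    -- an eigenvalue of the grading element that no raising generator can increase
    obtain ⟨k, hk, hk'⟩ : ∃ k : ℕ, H.HasEigenvalue (μ + k) ∧ ¬ H.HasEigenvalue (μ + k + 1) := by
      by_contra! hall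
      have hH : ∀ k : ℕ, μ + k ∈ {μ | H.HasEigenvalue μ} := by
        intro k
        induction k with
        | zero => simpa using hμ
        | succ k ih => simpa [add_assoc] using hall k ih
      exact Set.infinite_of_injective_forall_mem
        (fun k l h => by simpa using h) hH H.finite_hasEigenvalue
    refine ⟨H.eigenspace (μ + k), hk, fun j t m hm => ?_, fun i t m hm => ?_⟩
    · rw [Module.End.mem_eigenspace_iff] at hm ⊢
      change height Q • m = _ at hm
      change height Q • I Q j t • m = _
      rw [← mul_smul, height_mul_I, mul_smul, hm, smul_comm_complex]
    · rw [Module.End.mem_eigenspace_iff] at hm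
      change height Q • m = _ at hm
      by_contra hne
      refine hk' (Module.End.hasEigenvalue_of_hasEigenvector
        (Module.End.hasEigenvector_iff.2 ⟨Module.End.mem_eigenspace_iff.2 ?_, hne⟩))
      change height Q • Xp Q i t • m = _
      rw [← mul_smul, height_mul_Xp, add_smul, mul_smul, hm, smul_comm_complex, add_smul _ 1,
        one_smul]
  obtain ⟨S, ⟨hS0, hSI, hSX⟩, hmin⟩ := WellFounded.has_min
    (wellFounded_lt : WellFounded ((· < ·) : Submodule ℂ M → Submodule ℂ M → Prop)) {S | P S} hex
  -- by minimality, every `I_{j,t}` acts on `S` by a scalar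
  have hscalar : ∀ j t, ∃ c : ℂ, ∀ m ∈ S, I Q j t • m = c • m := by
    intro j t
    let f : Module.End ℂ M := Algebra.lsmul ℂ ℂ M (I Q j t)
    have : Nontrivial S := Submodule.nontrivial_iff_ne_bot.2 hS0
    obtain ⟨c, hc⟩ := Module.End.exists_eigenvalue (f.restrict (hSI j t))
    obtain ⟨⟨x, hxS⟩, hx⟩ := hc.exists_hasEigenvector
    have hxc : I Q j t • x = c • x := congrArg Subtype.val hx.apply_eq_smul
    refine ⟨c, fun m hm => ?_⟩
    have hPS : P (S ⊓ f.eigenspace c) := by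
      refine ⟨fun hbot => ?_, fun j' t' m hm => ⟨hSI j' t' m hm.1, ?_⟩,
        fun i' t' m hm => hSX i' t' m hm.1⟩
      · have : x ∈ (⊥ : Submodule ℂ M) := hbot ▸ ⟨hxS, Module.End.mem_eigenspace_iff.2 hxc⟩
        exact hx.2 (Subtype.ext ((Submodule.mem_bot ℂ).1 this))
      · have h := Module.End.mem_eigenspace_iff.1 hm.2
        change I Q j t • m = _ at h
        refine Module.End.mem_eigenspace_iff.2 ?_
        change I Q j t • I Q j' t' • m = _
        rw [← mul_smul, I_mul_I, mul_smul, h, smul_comm_complex]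
    have hle : S ≤ S ⊓ f.eigenspace c := by
      by_contra hlt
      exact hmin _ hPS (lt_of_le_not_ge inf_le_left hlt)
    exact Module.End.mem_eigenspace_iff.1 (hle hm).2
  choose w hw using hscalar
  obtain ⟨v, hv, hv0⟩ := Submodule.exists_mem_ne_zero_of_ne_bot hS0
  exact ⟨w, v, hv0, fun i t => hSX i t v hv, fun j t => hw j t v hv⟩

end Module

/-! ### Functionals on `ℂ[X]` and the rank one classification -/

theorem powerSum_zero (φ : ℂ[X]) : powerSum φ 0 = φ.natDegree := by
  simp [powerSum, (IsAlgClosed.splits φ).natDegree_eq_card_roots]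

theorem rankOneWeight_eq {q : ℂ} (φ : ℂ[X]) {β : ℂ} (hβ : β ∈ betaSet q) (t : ℕ) :
    rankOneWeight q φ β t = powerSum φ t + q⁻¹ ^ t * β := by
  rw [rankOneWeight]
  split_ifs with h1 h2
  · rw [h1, powerSum_zero, pow_zero, one_mul]
  · rw [hβ h2, mul_zero, add_zero]
  · rfl

theorem powerSum_eq_sum (φ : ℂ[X]) (t : ℕ) :
    powerSum φ t = ∑ γ ∈ φ.roots.toFinset, (φ.rootMultiplicity γ : ℂ) * γ ^ t := by
  rw [powerSum, Finset.sum_multiset_map_count]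
  simp only [count_roots, nsmul_eq_mul]

/-- A divisor with simple roots is detected by its roots. -/
theorem dvd_of_forall_eval_eq_zero {f p : ℂ[X]} (hf0 : f ≠ 0) (hf : f.roots.Nodup)
    (h : ∀ γ ∈ f.roots, p.eval γ = 0) : f ∣ p := by
  by_cases hp : p = 0
  · exact hp ▸ dvd_zero f
  · refine (IsAlgClosed.splits f).dvd_of_roots_le_roots hf0 ((Multiset.le_iff_subset hf).2 ?_)
    exact fun γ hγ => (mem_roots hp).2 (h γ hγ)

section RankOne

variable {q : ℂ} {u : ℂ[X] →ₗ[ℂ] ℂ} {f : ℂ[X]}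

theorem eval_inv_one_sub (hq : q ≠ 0) : (1 - C q * X).eval q⁻¹ = 0 := by
  simp [hq]

theorem eval_one_sub_ne_zero {γ : ℂ} (h : q ≠ 0 → γ ≠ q⁻¹) : (1 - C q * X).eval γ ≠ 0 := by
  intro h0
  rw [eval_sub, eval_one, eval_mul, eval_C, eval_X, sub_eq_zero] at h0
  have hq : q ≠ 0 := left_ne_zero_of_mul_eq_one h0.symm
  exact h hq (eq_inv_of_mul_eq_one_right h0.symm)

theorem one_sub_dvd {p : ℂ[X]} (h : q ≠ 0 → p.eval q⁻¹ = 0) : 1 - C q * X ∣ p := by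
  by_cases hq : q = 0
  · rw [hq, map_zero, zero_mul, sub_zero]
    exact one_dvd p
  · obtain ⟨r, rfl⟩ := dvd_iff_isRoot.2 (h hq)
    refine ⟨C (-q⁻¹) * r, ?_⟩
    have : (X - C q⁻¹ : ℂ[X]) = (1 - C q * X) * C (-q⁻¹) := by
      have h1 : C q * C q⁻¹ = (1 : ℂ[X]) := by rw [← C_mul, mul_inv_cancel₀ hq, C_1]
      rw [C_neg]
      linear_combination -X * h1
    rw [this, mul_assoc]

/-- If `f` divides `(1 - q x) c ^ 2` then `f` divides `c`: the functional `u` sees neither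
nilpotent elements modulo `f` nor the zero of `1 - q x`. -/
theorem dvd_of_dvd_mul_sq (hA : ∀ b, f ∣ b ↔ ∀ a, u ((1 - C q * X) * (a * b)) = 0)
    (hB : ∀ a b c, f ∣ (1 - C q * X) * (a * b) * b - C c * b →
      ∃ k : ℕ, u ((1 - C q * X) * (a * b)) = k * c)
    {c : ℂ[X]} (h : f ∣ (1 - C q * X) * c ^ 2) : f ∣ c := by
  refine (hA c).2 fun a => ?_
  obtain ⟨k, hk⟩ := hB a c 0 (by
    have : (1 - C q * X) * (a * c) * c - C 0 * c = (1 - C q * X) * c ^ 2 * a := by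
      rw [C_0]
      ring
    rw [this]
    exact h.mul_right a)
  rwa [mul_zero] at hk

/-- The rank one classification: a functional on `ℂ[X]` with an annihilator as in a finite
dimensional highest weight module is a nonnegative integral combination of evaluations away from
`q⁻¹`, up to a multiple of the evaluation at `q⁻¹`. -/
theorem exists_rankOneWeight_eq (hf0 : f ≠ 0)
    (hA : ∀ b, f ∣ b ↔ ∀ a, u ((1 - C q * X) * (a * b)) = 0)
    (hB : ∀ a b c, f ∣ (1 - C q * X) * (a * b) * b - C c * b →
      ∃ k : ℕ, u ((1 - C q * X) * (a * b)) = k * c) :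
    ∃ φ ∈ monicSet q, ∃ β ∈ betaSet q, ∀ t, u (X ^ t) = rankOneWeight q φ β t := by
  classical
  -- if `f = x ^ 2 y` then `f` divides `(x y) ^ 2`, hence `x y`
  have hsq : Squarefree f := by
    rintro x ⟨y, hy⟩
    obtain ⟨z, hz⟩ := dvd_of_dvd_mul_sq (c := x * y) hA hB
      ⟨(1 - C q * X) * y, by rw [hy]; ring⟩
    have hxy : x * y ≠ 0 := by
      intro h0
      rw [mul_assoc, h0, mul_zero] at hy
      exact hf0 hy
    refine IsUnit.of_mul_eq_one z (mul_left_cancel₀ hxy ?_)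
    rw [mul_one, ← mul_assoc, mul_comm (x * y) x, ← mul_assoc, ← hy, ← hz]
  have hnodup : f.roots.Nodup :=
    nodup_roots (PerfectField.separable_iff_squarefree.2 hsq)
  -- if `f = (x - q⁻¹) y` then `f` divides `(1 - q x) y ^ 2`, hence `y`
  have hfq : q ≠ 0 → f.eval q⁻¹ ≠ 0 := by
    intro hq h0
    obtain ⟨y, hy⟩ := dvd_iff_isRoot.2 h0
    have hy0 : y ≠ 0 := by
      rintro rfl
      exact hf0 (hy.trans (mul_zero _))
    obtain ⟨r, hr⟩ := one_sub_dvd (q := q) (p := X - C q⁻¹) fun _ => by simp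
    obtain ⟨s, hs⟩ := dvd_iff_isRoot.2 (eval_inv_one_sub hq)
    obtain ⟨z, hz⟩ := dvd_of_dvd_mul_sq (c := y) hA hB
      ⟨s * y, by rw [hy, hs]; ring⟩
    have : IsUnit (X - C q⁻¹) := by
      refine IsUnit.of_mul_eq_one z (mul_left_cancel₀ hy0 ?_)
      rw [mul_one, ← mul_assoc, mul_comm y, ← hy, ← hz]
    exact not_isUnit_X_sub_C _ this
  have hroot : ∀ γ ∈ f.roots, q ≠ 0 → γ ≠ q⁻¹ := by
    rintro γ hγ hq rfl
    exact hfq hq ((mem_roots hf0).1 hγ)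
  have hvanish : ∀ p : ℂ[X], (∀ γ ∈ f.roots, p.eval γ = 0) → (q ≠ 0 → p.eval q⁻¹ = 0) →
      u p = 0 := by
    intro p hp hpq
    obtain ⟨h, rfl⟩ := dvd_of_forall_eval_eq_zero hf0 hnodup hp
    obtain ⟨r, rfl⟩ := one_sub_dvd (q := q) (p := h) fun hq => by
      have := hpq hq
      rw [eval_mul] at this
      exact (mul_eq_zero.1 this).resolve_left (hfq hq)
    have := (hA f).1 dvd_rfl r
    rwa [mul_comm f, mul_assoc]
  -- interpolation polynomials for the roots of `f`
  have hinterp : ∀ γ : ℂ, ∃ e : ℂ[X], γ ∈ f.roots → e.eval γ = 1 ∧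
      (∀ γ' ∈ f.roots, γ' ≠ γ → e.eval γ' = 0) ∧ (q ≠ 0 → e.eval q⁻¹ = 0) ∧
      ∃ k : ℕ, u e = k := by
    intro γ
    by_cases hγ : γ ∈ f.roots
    swap
    · exact ⟨0, fun h => absurd h hγ⟩
    obtain ⟨b, hb⟩ := dvd_iff_isRoot.2 (isRoot_of_mem_roots hγ)
    have hbγ : b.eval γ ≠ 0 := by
      intro h0
      obtain ⟨y, rfl⟩ := dvd_iff_isRoot.2 h0
      exact not_isUnit_X_sub_C γ (hsq _ ⟨y, by rw [hb, mul_assoc]⟩)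
    have hLγ := eval_one_sub_ne_zero (hroot γ hγ)
    let a : ℂ[X] := C ((((1 - C q * X).eval γ) * b.eval γ)⁻¹)
    have hone : ((1 - C q * X) * (a * b)).eval γ = 1 := by
      rw [eval_mul, eval_mul, eval_C, mul_left_comm, inv_mul_cancel₀ (mul_ne_zero hLγ hbγ)]
    refine ⟨(1 - C q * X) * (a * b), fun _ => ⟨hone, fun γ' hγ' hne => ?_, fun hq => ?_, ?_⟩⟩
    · have h0 : f.eval γ' = 0 := isRoot_of_mem_roots hγ'
      rw [hb, eval_mul, eval_sub, eval_X, eval_C] at h0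
      rw [eval_mul, eval_mul, (mul_eq_zero.1 h0).resolve_left (sub_ne_zero.2 hne), mul_zero,
        mul_zero]
    · rw [eval_mul, eval_inv_one_sub hq, zero_mul]
    · obtain ⟨k, hk⟩ := hB a b 1 (by
        obtain ⟨z, hz⟩ : X - C γ ∣ (1 - C q * X) * (a * b) - 1 :=
          dvd_iff_isRoot.2 (by rw [IsRoot.def, eval_sub, hone, eval_one, sub_self])
        refine ⟨z, ?_⟩
        rw [C_1, ← sub_mul, hz, hb]
        ring)
      exact ⟨k, by rw [hk, mul_one]⟩
  choose e he using hinterp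
  have hk : ∀ γ, ∃ k : ℕ, γ ∈ f.roots → u (e γ) = k := by
    intro γ
    by_cases hγ : γ ∈ f.roots
    · obtain ⟨k, hk⟩ := (he γ hγ).2.2.2
      exact ⟨k, fun _ => hk⟩
    · exact ⟨0, fun h => absurd h hγ⟩
  choose k hk using hk
  have hφ0 : ∏ γ ∈ f.roots.toFinset, (X - C γ) ^ k γ ≠ 0 :=
    Finset.prod_ne_zero_iff.2 fun γ _ => pow_ne_zero _ (X_sub_C_ne_zero γ)
  refine ⟨∏ γ ∈ f.roots.toFinset, (X - C γ) ^ k γ,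
    ⟨monic_prod_of_monic _ _ fun γ _ => (monic_X_sub_C γ).pow _, fun hq h0 => ?_⟩,
    if q = 0 then 0 else u f / f.eval q⁻¹, fun hq => if_pos hq, fun t => ?_⟩
  · rw [IsRoot.def, eval_prod, Finset.prod_eq_zero_iff] at h0
    obtain ⟨γ, hγ, h1⟩ := h0
    rw [eval_pow, eval_sub, eval_X, eval_C] at h1
    exact hroot γ (Multiset.mem_toFinset.1 hγ) hq (sub_eq_zero.1 (eq_zero_of_pow_eq_zero h1)).symm
  · have hpow : powerSum (∏ γ ∈ f.roots.toFinset, (X - C γ) ^ k γ) t =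
        ∑ γ ∈ f.roots.toFinset, γ ^ t * u (e γ) := by
      rw [powerSum, roots_prod _ _ hφ0, Multiset.map_bind, Multiset.sum_bind]
      refine Finset.sum_congr rfl fun γ hγ => ?_
      rw [roots_pow, roots_X_sub_C, hk γ (Multiset.mem_toFinset.1 hγ), Multiset.map_nsmul,
        Multiset.sum_nsmul, Multiset.map_singleton, Multiset.sum_singleton, nsmul_eq_mul, mul_comm]
    rw [rankOneWeight_eq _ (fun hq => if_pos hq), hpow]
    -- Lagrange interpolation of `X ^ t` at the roots of `f` and at `q⁻¹`
    have h := hvanish (X ^ t - ∑ γ ∈ f.roots.toFinset, C (γ ^ t) * e γ -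
      if q = 0 then 0 else C (q⁻¹ ^ t / f.eval q⁻¹) * f) (fun γ hγ => ?_) (fun hq => ?_)
    · rw [map_sub, map_sub, map_sum, sub_eq_zero, sub_eq_iff_eq_add'] at h
      rw [h]
      congr 1
      · exact Finset.sum_congr rfl fun γ _ => by rw [← smul_eq_C_mul, map_smul, smul_eq_mul]
      · split_ifs
        · rw [map_zero, mul_zero]
        · rw [← smul_eq_C_mul, map_smul, smul_eq_mul]
          ring
    · have h1 : (if q = 0 then 0 else C (q⁻¹ ^ t / f.eval q⁻¹) * f).eval γ = 0 := by
        split_ifs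
        · exact eval_zero
        · rw [eval_mul, (isRoot_of_mem_roots hγ : f.eval γ = 0), mul_zero]
      rw [eval_sub, eval_sub, h1, sub_zero, eval_finsetSum, Finset.sum_eq_single γ]
      · rw [eval_mul, (he γ hγ).1, eval_pow, eval_X, eval_C, mul_one, sub_self]
      · intro γ' hγ' hne
        rw [eval_mul, (he γ' (Multiset.mem_toFinset.1 hγ')).2.1 γ hγ hne.symm, mul_zero]
      · exact fun h => absurd (Multiset.mem_toFinset.2 hγ) h
    · rw [if_neg hq, eval_sub, eval_sub, eval_finsetSum, Finset.sum_eq_zero, eval_mul, eval_C,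
        div_mul_cancel₀ _ (hfq hq), eval_pow, eval_X, sub_zero, sub_self]
      intro γ hγ
      rw [eval_mul, (he γ (Multiset.mem_toFinset.1 hγ)).2.2.1 hq, mul_zero]

end RankOne

section Module

variable {M : Type*} [AddCommGroup M] [Module ℂ M] [Module (U Q) M] [IsScalarTower ℂ (U Q) M]

/-- The highest weight of a finite dimensional simple module has the rank one form at every
node. -/
theorem IsHighestWeightVector.exists_rankOneWeight_eq [FiniteDimensional ℂ M]
    [IsSimpleModule (U Q) M] {w : Fin (n + 1) → ℕ → ℂ} {v : M}
    (hv : IsHighestWeightVector Q w v) (h0 : v ≠ 0) (i : Fin n) :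
    ∃ φ ∈ monicSet (Q i), ∃ β ∈ betaSet (Q i),
      ∀ t, w i.castSucc t - w i.succ t = rankOneWeight (Q i) φ β t := by
  obtain ⟨f, hf⟩ := (IsPrincipalIdealRing.principal (hv.annIdeal i)).principal
  have hmem : ∀ b, f ∣ b ↔ b ∈ hv.annIdeal i := fun b => by
    rw [hf]
    exact Ideal.mem_span_singleton.symm
  have hf0 : f ≠ 0 := by
    rintro rfl
    exact hv.annIdeal_ne_bot i (hf.trans (Submodule.span_singleton_eq_bot.2 rfl))
  obtain ⟨φ, hφ, β, hβ, h⟩ := DeformedCurrent.exists_rankOneWeight_eq (q := Q i)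
    (u := nodeFunctional w i) hf0 (fun b => (hmem b).trans (hv.mem_annIdeal_iff h0 i b))
    (fun a b c hdvd => hv.exists_nat_nodeFunctional_eq h0 (by
      have h1 := hv.mem_annIdeal.1 ((hmem _).1 hdvd)
      rwa [map_sub, sub_smul, sub_eq_zero, ← smul_eq_C_mul c, map_smul, smul_assoc] at h1))
  exact ⟨φ, hφ, β, hβ, fun t => by rw [← h t, nodeFunctional, polyMap_X_pow]⟩

end Module

/-! ### Weights determine the parameters -/

/-- Distinct exponential sequences `t ↦ γ ^ t` are linearly independent. -/
theorem eq_zero_of_sum_mul_pow_eq_zero (T : Finset ℂ) (d : ℂ → ℂ)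
    (h : ∀ t : ℕ, ∑ γ ∈ T, d γ * γ ^ t = 0) {γ : ℂ} (hγ : γ ∈ T) : d γ = 0 := by
  have hli := (linearIndependent_monoidHom (Multiplicative ℕ) ℂ).comp (fun γ : ℂ => powersHom ℂ γ)
    (powersHom ℂ).injective
  refine linearIndependent_iff'.1 hli T d (funext fun t => ?_) γ hγ
  simpa using h t.toAdd

/-- The sequence determines the multiplicities of all roots and, as `q⁻¹` is not a root, also the
coefficient of `q⁻¹ ^ t`. -/
theorem eq_of_rankOneWeight_eq {q : ℂ} {φ φ' : ℂ[X]} {β β' : ℂ} (hφ : φ ∈ monicSet q)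
    (hφ' : φ' ∈ monicSet q) (hβ : β ∈ betaSet q) (hβ' : β' ∈ betaSet q)
    (h : ∀ t, rankOneWeight q φ β t = rankOneWeight q φ' β' t) : φ = φ' ∧ β = β' := by
  classical
  let T : Finset ℂ := insert q⁻¹ (φ.roots.toFinset ∪ φ'.roots.toFinset)
  have hsum : ∀ ψ : ℂ[X], ψ.roots.toFinset ⊆ T → ∀ t,
      powerSum ψ t = ∑ γ ∈ T, (ψ.rootMultiplicity γ : ℂ) * γ ^ t := by
    intro ψ hψ t
    rw [powerSum_eq_sum]
    refine Finset.sum_subset hψ fun γ _ hγ => ?_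
    rw [Multiset.mem_toFinset, ← Multiset.count_eq_zero, count_roots] at hγ
    rw [hγ, Nat.cast_zero, zero_mul]
  have hT : φ.roots.toFinset ⊆ T := fun γ hγ =>
    Finset.mem_insert_of_mem (Finset.mem_union_left _ hγ)
  have hT' : φ'.roots.toFinset ⊆ T := fun γ hγ =>
    Finset.mem_insert_of_mem (Finset.mem_union_right _ hγ)
  have hqT : q⁻¹ ∈ T := Finset.mem_insert_self _ _
  have hd := fun γ => eq_zero_of_sum_mul_pow_eq_zero T
    (fun γ => (φ.rootMultiplicity γ : ℂ) - φ'.rootMultiplicity γ +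
      if γ = q⁻¹ then β - β' else 0) (fun t => by
        have h1 := h t
        rw [rankOneWeight_eq _ hβ, rankOneWeight_eq _ hβ', hsum _ hT, hsum _ hT'] at h1
        simp only [add_mul, sub_mul, ite_mul, zero_mul, Finset.sum_add_distrib,
          Finset.sum_sub_distrib, Finset.sum_ite_eq', if_pos hqT]
        linear_combination h1) (γ := γ)
  have hββ : β = β' := by
    by_cases hq : q = 0
    · rw [hβ hq, hβ' hq]
    · have h1 := hd q⁻¹ hqT
      rw [if_pos rfl, rootMultiplicity_eq_zero (hφ.2 hq), rootMultiplicity_eq_zero (hφ'.2 hq),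
        sub_self, zero_add] at h1
      exact sub_eq_zero.1 h1
  refine ⟨?_, hββ⟩
  have hroots : φ.roots = φ'.roots := by
    refine Multiset.ext' fun γ => ?_
    by_cases hγ : γ ∈ T
    · have h1 := hd γ hγ
      rw [hββ, sub_self, ite_self, add_zero, sub_eq_zero] at h1
      rw [count_roots, count_roots]
      exact_mod_cast h1
    · rw [Multiset.count_eq_zero_of_notMem fun h => hγ (hT (Multiset.mem_toFinset.2 h)),
        Multiset.count_eq_zero_of_notMem fun h => hγ (hT' (Multiset.mem_toFinset.2 h))]
  rw [(IsAlgClosed.splits φ).eq_prod_roots_of_monic hφ.1,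
    (IsAlgClosed.splits φ').eq_prod_roots_of_monic hφ'.1, hroots]

theorem weight_last (p : Param Q) (t : ℕ) : weight Q p (Fin.last n) t = p.2 t := by
  rw [weight, Finset.sum_eq_zero, zero_add]
  intro k hk
  exact absurd (Finset.mem_filter.1 hk).2 (not_le_of_gt k.castSucc_lt_last)

theorem weight_castSucc (p : Param Q) (i : Fin n) (t : ℕ) :
    weight Q p i.castSucc t =
      rankOneWeight (Q i) (p.1 i).1 (p.1 i).2 t + weight Q p i.succ t := by
  have h : (Finset.univ.filter fun k : Fin n => i.castSucc ≤ k.castSucc) =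
      insert i (Finset.univ.filter fun k : Fin n => i.succ ≤ k.castSucc) := by
    ext k
    simp only [Finset.mem_filter, Finset.mem_univ, true_and, Finset.mem_insert, Fin.le_def,
      Fin.val_castSucc, Fin.val_succ, Fin.ext_iff]
    omega
  have hi : i ∉ Finset.univ.filter fun k : Fin n => i.succ ≤ k.castSucc := by
    simp [Fin.le_def]
  rw [weight, weight, h, Finset.sum_insert hi, add_assoc]

theorem weight_injective : Function.Injective (weight Q) := by
  intro p p' h
  refine Prod.ext (funext fun i => ?_) (funext fun t => ?_)
  · have h1 := eq_of_rankOneWeight_eq (p.1 i).1.2 (p'.1 i).1.2 (p.1 i).2.2 (p'.1 i).2.2 fun t => by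
      have h2 := weight_castSucc p i t
      rw [h, weight_castSucc p' i t] at h2
      exact (add_right_cancel h2).symm
    exact Prod.ext (Subtype.ext h1.1) (Subtype.ext h1.2)
  · rw [← weight_last p, ← weight_last p', h]

/-- A weight whose differences at all nodes have the rank one form is parametrized. -/
theorem exists_weight_eq {w : Fin (n + 1) → ℕ → ℂ}
    (h : ∀ i, ∃ φ ∈ monicSet (Q i), ∃ β ∈ betaSet (Q i),
      ∀ t, w i.castSucc t - w i.succ t = rankOneWeight (Q i) φ β t) :
    ∃ p : Param Q, weight Q p = w := by
  choose φ hφ β hβ h using h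
  refine ⟨(fun i => (⟨φ i, hφ i⟩, ⟨β i, hβ i⟩), w (Fin.last n)), funext fun j => ?_⟩
  induction j using Fin.reverseInduction with
  | last => exact funext fun t => weight_last _ t
  | cast i ih =>
    funext t
    rw [weight_castSucc, ih, ← h, sub_add_cancel]

/-! ### Realization of the weights in finite dimensional representations -/

/-- The weight `w` is the weight of a nonzero highest weight vector in some finite dimensional
representation. -/
def Realizable (Q : Fin n → ℂ) (w : Fin (n + 1) → ℕ → ℂ) : Prop :=
  ∃ (V : Type) (_ : AddCommGroup V) (_ : Module ℂ V) (_ : FiniteDimensional ℂ V)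
    (ρ : DeformedGL Q →ₗ⁅ℂ⁆ Module.End ℂ V) (v : V), v ≠ 0 ∧
    (∀ i t, ρ (toDeformedGL Q (fXp i t)) v = 0) ∧
    ∀ j t, ρ (toDeformedGL Q (fI j t)) v = w j t • v

theorem Realizable.exists_module {w : Fin (n + 1) → ℕ → ℂ} (h : Realizable Q w) :
    ∃ (V : Type) (_ : AddCommGroup V) (_ : Module ℂ V) (_ : FiniteDimensional ℂ V)
      (_ : Module (U Q) V) (_ : IsScalarTower ℂ (U Q) V) (v : V),
      v ≠ 0 ∧ IsHighestWeightVector Q w v := by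
  obtain ⟨V, _, _, hV, ρ, v, h0, hX, hI⟩ := h
  let R : U Q →ₐ[ℂ] Module.End ℂ V := UniversalEnvelopingAlgebra.lift ℂ ρ
  let _ : Module (U Q) V := Module.compHom V R.toRingHom
  have hsmul : ∀ (x : U Q) (y : V), x • y = R x y := fun _ _ => rfl
  refine ⟨V, _, _, hV, inferInstance, ⟨fun c x y => ?_⟩, v, h0, fun i t => ?_, fun j t => ?_⟩
  · rw [hsmul, hsmul, map_smul, LinearMap.smul_apply]
  · rw [hsmul, ← hX i t]
    exact LinearMap.congr_fun (UniversalEnvelopingAlgebra.lift_ι_apply ℂ ρ _) v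
  · rw [hsmul, ← hI j t]
    exact LinearMap.congr_fun (UniversalEnvelopingAlgebra.lift_ι_apply ℂ ρ _) v

open TensorProduct in
/-- The sum of the weights of two highest weight vectors is realized in the tensor product. -/
theorem Realizable.add {w w' : Fin (n + 1) → ℕ → ℂ} (h : Realizable Q w) (h' : Realizable Q w') :
    Realizable Q (w + w') := by
  obtain ⟨V, _, _, _, ρ, v, h0, hX, hI⟩ := h
  obtain ⟨V', _, _, _, ρ', v', h0', hX', hI'⟩ := h'
  refine ⟨V ⊗[ℂ] V', inferInstance, inferInstance, inferInstance,
    { toFun := fun x => (ρ x).rTensor V' + (ρ' x).lTensor V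
      map_add' := fun x y => by
        rw [map_add, map_add, LinearMap.rTensor_add, LinearMap.lTensor_add]
        abel
      map_smul' := fun c x => by
        rw [map_smul, map_smul, LinearMap.rTensor_smul, LinearMap.lTensor_smul, smul_add,
          RingHom.id_apply]
      map_lie' := fun {x y} => by
        refine TensorProduct.ext' fun a b => ?_
        simp only [LieHom.map_lie, LieRing.of_associative_ring_bracket, LinearMap.add_apply,
          LinearMap.sub_apply, Module.End.mul_apply, LinearMap.rTensor_tmul,
          LinearMap.lTensor_tmul, map_add, TensorProduct.sub_tmul, TensorProduct.tmul_sub]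
        abel }, v ⊗ₜ v', ?_, fun i t => ?_, fun j t => ?_⟩
  · obtain ⟨f, hf⟩ := not_forall.1 (mt (Module.forall_dual_apply_eq_zero_iff ℂ v).1 h0)
    obtain ⟨g, hg⟩ := not_forall.1 (mt (Module.forall_dual_apply_eq_zero_iff ℂ v').1 h0')
    intro h
    have h1 := congrArg (TensorProduct.lid ℂ ℂ ∘ TensorProduct.map f g) h
    simp only [Function.comp_apply, TensorProduct.map_tmul, TensorProduct.lid_tmul, map_zero,
      smul_eq_mul] at h1
    exact mul_ne_zero hf hg h1
  · change (ρ _).rTensor V' (v ⊗ₜ v') + (ρ' _).lTensor V (v ⊗ₜ v') = 0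
    rw [LinearMap.rTensor_tmul, LinearMap.lTensor_tmul, hX, hX', TensorProduct.zero_tmul,
      TensorProduct.tmul_zero, add_zero]
  · change (ρ _).rTensor V' (v ⊗ₜ v') + (ρ' _).lTensor V (v ⊗ₜ v') = _
    rw [LinearMap.rTensor_tmul, LinearMap.lTensor_tmul, hI, hI', TensorProduct.tmul_smul,
      ← TensorProduct.smul_tmul', ← add_smul]
    rfl

/-- One dimensional representations: the generators `X^±` act by zero, which forces
`J_{i,t} = Q_i J_{i,t+1}`. -/
theorem realizable_of_character {w : Fin (n + 1) → ℕ → ℂ}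
    (hw : ∀ i t, w i.castSucc t - w i.succ t =
      Q i * (w i.castSucc (t + 1) - w i.succ (t + 1))) : Realizable Q w := by
  obtain ⟨ρ, hXp, -, hI⟩ := exists_lieHom (Q := Q) (A := Module.End ℂ ℂ) (fun g => match g with
    | .Xp _ _ => 0
    | .Xm _ _ => 0
    | .I j t => algebraMap ℂ (Module.End ℂ ℂ) (w j t)) (by
      rintro x (⟨i, j, s, t⟩ | ⟨j, i, s, t⟩ | ⟨j, i, s, t⟩ | ⟨i, t, s⟩ | ⟨i, j, t, s, h⟩ |
        ⟨i, j, t, s, h⟩ | ⟨i, j, t, s, h⟩ | ⟨i, j, t, s, h⟩ | ⟨i, j, t, s, h⟩ |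
        ⟨i, j, s, t, u, h⟩ | ⟨i, j, s, t, u, h⟩) <;>
      simp only [fXp, fXm, fI, fJ, map_sub, map_add, map_smul, LieHom.map_lie,
        FreeLieAlgebra.lift_of_apply, LieRing.of_associative_ring_bracket, mul_zero, zero_mul,
        smul_zero, sub_zero, add_zero]
      · rw [Algebra.commutes, sub_self]
      · rw [← map_sub, ← map_sub, hw, zero_sub, neg_eq_zero, sub_eq_zero, map_mul,
          Algebra.smul_def])
  refine ⟨ℂ, inferInstance, inferInstance, inferInstance, ρ, 1, one_ne_zero, fun i t => ?_,
    fun j t => ?_⟩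
  · rw [hXp, LinearMap.zero_apply]
  · rw [hI, Module.algebraMap_end_apply]

theorem realizable_zero : Realizable Q 0 :=
  realizable_of_character fun i t => by simp

section MatrixUnits

variable {A : Type*} [Ring A] [Algebra ℂ A]

theorem smul_bracket_smul (x y : ℂ) (a b : A) : ⁅x • a, y • b⁆ = (x * y) • ⁅a, b⁆ := by
  rw [LieRing.of_associative_ring_bracket, LieRing.of_associative_ring_bracket,
    smul_mul_smul_comm, smul_mul_smul_comm, smul_sub, mul_comm y]

theorem serre_of_matrixUnits {ι : Type*} [DecidableEq ι] (E : ι → ι → A)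
    (hE : ∀ a b c d, ⁅E a b, E c d⁆ =
      (if b = c then E a d else 0) - (if d = a then E c b else 0)) {a b c d : ι} (hab : a ≠ b)
    (h : ¬ (b = c ∧ d = a)) :
    ⁅E a b, (if b = c then E a d else 0) - (if d = a then E c b else 0)⁆ = 0 := by
  by_cases hbc : b = c
  · have hda : d ≠ a := fun hda => h ⟨hbc, hda⟩
    rw [if_pos hbc, if_neg hda, sub_zero, hE, if_neg hab.symm, if_neg hda, sub_zero]
  · by_cases hda : d = a
    · rw [if_neg hbc, if_pos hda, zero_sub, ← neg_one_smul ℂ (E c b), ← one_smul ℂ (E a b),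
        smul_bracket_smul, hE, if_neg hbc, if_neg hab.symm, sub_zero, smul_zero]
    · rw [if_neg hbc, if_neg hda, sub_zero, LieRing.of_associative_ring_bracket, mul_zero,
        zero_mul, sub_zero]

/-- Evaluation at `γ`: matrix units `E a b` in an associative algebra give a representation with
`X⁺_{i,t} ↦ γ ^ t E_{i,i+1}`, `X⁻_{i,t} ↦ (1 - Q_i γ) γ ^ t E_{i+1,i}` and
`I_{j,t} ↦ γ ^ t E_{j,j}`. -/
theorem lift_eq_zero_of_matrixUnits (E : Fin (n + 1) → Fin (n + 1) → A)
    (hE : ∀ a b c d, ⁅E a b, E c d⁆ =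
      (if b = c then E a d else 0) - (if d = a then E c b else 0)) (γ : ℂ)
    (x : Free n) (hx : IsRelator Q x) :
    FreeLieAlgebra.lift ℂ (fun g : Gen n => match g with
      | .Xp i t => γ ^ t • E i.castSucc i.succ
      | .Xm i t => ((1 - Q i * γ) * γ ^ t) • E i.succ i.castSucc
      | .I j t => γ ^ t • E j j) x = 0 := by
  obtain ⟨i, j, s, t⟩ | ⟨j, i, s, t⟩ | ⟨j, i, s, t⟩ | ⟨i, t, s⟩ | ⟨i, j, t, s, h⟩ |
        ⟨i, j, t, s, h⟩ | ⟨i, j, t, s, h⟩ | ⟨i, j, t, s, h⟩ | ⟨i, j, t, s, h⟩ |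
        ⟨i, j, s, t, u, h⟩ | ⟨i, j, s, t, u, h⟩ := hx <;>
  simp only [fXp, fXm, fI, fJ, map_sub, map_add, map_smul, LieHom.map_lie,
        FreeLieAlgebra.lift_of_apply, smul_bracket_smul, hE, Fin.succ_inj, Fin.castSucc_inj]
  · split_ifs with h1 h2 h2
    · subst h1; simp
    · exact absurd h1.symm h2
    · exact absurd h2.symm h1
    · simp
  · rw [aCoeff]
    by_cases h1 : j = i.castSucc
    · subst h1
      simp only [i.castSucc_lt_succ.ne', if_true, if_false]
      module
    · by_cases h2 : j = i.succ
      · subst h2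
        simp only [i.castSucc_lt_succ.ne', if_true, if_false]
        module
      · simp only [h1, h2, Ne.symm h2, if_false]
        module
  · rw [aCoeff]
    by_cases h1 : j = i.castSucc
    · subst h1
      simp only [i.castSucc_lt_succ.ne, if_true, if_false]
      module
    · by_cases h2 : j = i.succ
      · subst h2
        simp only [i.castSucc_lt_succ.ne', i.castSucc_lt_succ.ne, if_true, if_false]
        module
      · simp only [h1, h2, Ne.symm h1, if_false]
        module
  · simp only [if_true]
    module
  · simp only [h, Ne.symm h, if_false]
    module
  all_goals unfold Adj at h
  · rw [if_neg (by rw [Fin.ext_iff, Fin.val_succ, Fin.val_castSucc]; omega),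
      if_neg (by rw [Fin.ext_iff, Fin.val_succ, Fin.val_castSucc]; omega)]
    module
  · rw [if_neg (by rw [Fin.ext_iff, Fin.val_succ, Fin.val_castSucc]; omega),
      if_neg (by rw [Fin.ext_iff, Fin.val_succ, Fin.val_castSucc]; omega)]
    module
  · module
  · module
  · rw [serre_of_matrixUnits E hE i.castSucc_lt_succ.ne, smul_zero]
    simp only [Fin.ext_iff, Fin.val_succ, Fin.val_castSucc]
    omega
  · rw [serre_of_matrixUnits E hE i.castSucc_lt_succ.ne', smul_zero]
    simp only [Fin.ext_iff, Fin.val_succ, Fin.val_castSucc]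
    omega

end MatrixUnits

section Exterior

open CliffordAlgebra

/-- The exterior algebra of `ℂ ^ (n + 1)`. -/
abbrev Ext (n : ℕ) : Type := ExteriorAlgebra ℂ (Fin (n + 1) → ℂ)

/-- The basis vector of `ℂ ^ (n + 1)` of index `r`, or zero if `r` is out of range. -/
def basisVec (n r : ℕ) : Fin (n + 1) → ℂ := fun j => if (j : ℕ) = r then 1 else 0

/-- Exterior multiplication by a basis vector. -/
def wedgeOp (n r : ℕ) : Module.End ℂ (Ext n) :=
  LinearMap.mulLeft ℂ (ExteriorAlgebra.ι ℂ (basisVec n r))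

/-- Contraction with a coordinate function. -/
def contractOp (n : ℕ) (b : Fin (n + 1)) : Module.End ℂ (Ext n) :=
  contractLeft (LinearMap.proj b)

theorem contractOp_wedgeOp (b : Fin (n + 1)) (r : ℕ) (x : Ext n) :
    contractOp n b (wedgeOp n r x) =
      (if (b : ℕ) = r then x else 0) - wedgeOp n r (contractOp n b x) := by
  refine (contractLeft_ι_mul _ _ x).trans ?_
  congr 1
  rw [LinearMap.proj_apply, basisVec, ite_smul, one_smul, zero_smul]

theorem wedgeOp_wedgeOp (r s : ℕ) (x : Ext n) :
    wedgeOp n r (wedgeOp n s x) = -wedgeOp n s (wedgeOp n r x) := by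
  rw [eq_neg_iff_add_eq_zero]
  change _ * (_ * x) + _ * (_ * x) = 0
  rw [← mul_assoc, ← mul_assoc, ← add_mul, ExteriorAlgebra.ι_add_mul_swap, zero_mul]

theorem wedgeOp_self (r : ℕ) (x : Ext n) : wedgeOp n r (wedgeOp n r x) = 0 := by
  change _ * (_ * x) = 0
  rw [← mul_assoc, ExteriorAlgebra.ι_sq_zero, zero_mul]

theorem contractOp_contractOp (a b : Fin (n + 1)) (x : Ext n) :
    contractOp n a (contractOp n b x) = -contractOp n b (contractOp n a x) :=
  contractLeft_comm _ _ x

/-- The action of the matrix unit `E_{a,b}` on the exterior algebra by a derivation. -/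
def extE (n : ℕ) (a b : Fin (n + 1)) : Module.End ℂ (Ext n) := wedgeOp n a * contractOp n b

theorem extE_apply (a b : Fin (n + 1)) (x : Ext n) :
    extE n a b x = wedgeOp n a (contractOp n b x) := rfl

theorem bracket_extE (a b c d : Fin (n + 1)) :
    ⁅extE n a b, extE n c d⁆ =
      (if b = c then extE n a d else 0) - (if d = a then extE n c b else 0) := by
  refine LinearMap.ext fun x => ?_
  have h1 : ∀ (p : Prop) [Decidable p] (f : Module.End ℂ (Ext n)),
      (if p then f else 0) x = if p then f x else 0 := by
    intro p _ f
    split_ifs <;> rfl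
  rw [LieRing.of_associative_ring_bracket, LinearMap.sub_apply, LinearMap.sub_apply, h1, h1,
    Module.End.mul_apply, Module.End.mul_apply]
  simp only [extE_apply, contractOp_wedgeOp, map_sub, Fin.val_inj, apply_ite (wedgeOp n _),
    map_zero]
  rw [wedgeOp_wedgeOp a c, contractOp_contractOp b d, map_neg, map_neg]
  abel

/-- The exterior product of the first `r` basis vectors. -/
def topWedge (n : ℕ) : ℕ → Ext n
  | 0 => 1
  | r + 1 => wedgeOp n r (topWedge n r)

theorem contractOp_topWedge {b : Fin (n + 1)} {r : ℕ} (h : r ≤ b) :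
    contractOp n b (topWedge n r) = 0 := by
  induction r with
  | zero =>
    exact contractLeft_one (Q := (0 : QuadraticForm ℂ (Fin (n + 1) → ℂ))) (LinearMap.proj b)
  | succ r ih =>
    rw [topWedge, contractOp_wedgeOp, if_neg (by omega), ih (by omega), map_zero, sub_zero]

theorem wedgeOp_topWedge {a r : ℕ} (h : a < r) : wedgeOp n a (topWedge n r) = 0 := by
  induction r with
  | zero => omega
  | succ r ih =>
    rw [topWedge]
    rcases Nat.lt_succ_iff_lt_or_eq.1 h with h | rfl
    · rw [wedgeOp_wedgeOp, ih h, map_zero, neg_zero]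
    · exact wedgeOp_self _ _

theorem topWedge_ne_zero {r : ℕ} (h : r ≤ n + 1) : topWedge n r ≠ 0 := by
  induction r with
  | zero => exact one_ne_zero
  | succ r ih =>
    intro h0
    refine ih (by omega) ?_
    have h1 := contractOp_wedgeOp ⟨r, h⟩ r (topWedge n r)
    rwa [if_pos rfl, contractOp_topWedge le_rfl, map_zero, sub_zero, ← topWedge, h0, map_zero,
      eq_comm] at h1

theorem extE_topWedge_self (a : Fin (n + 1)) (r : ℕ) :
    extE n a a (topWedge n r) = if (a : ℕ) < r then topWedge n r else 0 := by
  rw [extE_apply]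
  split_ifs with h
  · have h1 := contractOp_wedgeOp a a (topWedge n r)
    rw [wedgeOp_topWedge h, map_zero, if_pos rfl, eq_comm, sub_eq_zero] at h1
    exact h1.symm
  · rw [contractOp_topWedge (not_lt.1 h), map_zero]

theorem extE_topWedge_succ (i : Fin n) (r : ℕ) :
    extE n i.castSucc i.succ (topWedge n r) = 0 := by
  rw [extE_apply]
  by_cases h : (i.succ : ℕ) < r
  · have h1 := contractOp_wedgeOp i.succ i.castSucc (topWedge n r)
    rw [wedgeOp_topWedge (by simp at h ⊢; omega), map_zero, if_neg (by simp), zero_sub, eq_comm,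
      neg_eq_zero] at h1
    exact h1
  · rw [contractOp_topWedge (not_lt.1 h), map_zero]

instance : FiniteDimensional ℂ (Ext n) :=
  Module.Finite.of_basis (Pi.basisFun ℂ (Fin (n + 1))).ExteriorAlgebra

/-- The fundamental weights, evaluated at a point `γ`: they occur in the exterior powers of the
vector representation. -/
theorem realizable_fundamental (k : Fin n) (γ : ℂ) :
    Realizable Q fun j t => if j ≤ k.castSucc then γ ^ t else 0 := by
  obtain ⟨ρ, hXp, -, hI⟩ := exists_lieHom (Q := Q) _
    (lift_eq_zero_of_matrixUnits (extE n) bracket_extE γ)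
  refine ⟨Ext n, inferInstance, inferInstance, inferInstance, ρ, topWedge n (k + 1),
    topWedge_ne_zero (by omega), fun i t => ?_, fun j t => ?_⟩
  · rw [hXp, LinearMap.smul_apply, extE_topWedge_succ, smul_zero]
  · rw [hI, LinearMap.smul_apply, extE_topWedge_self, ite_smul, zero_smul, smul_ite, smul_zero]
    simp only [Fin.le_def, Fin.val_castSucc, Nat.lt_succ_iff]

end Exterior

/-- The one dimensional weights attached to a zero of `1 - Q_k x`. -/
theorem realizable_inv (k : Fin n) {β : ℂ} (hβ : β ∈ betaSet (Q k)) :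
    Realizable Q fun j t => if j ≤ k.castSucc then (Q k)⁻¹ ^ t * β else 0 := by
  refine realizable_of_character fun i t => ?_
  rcases lt_trichotomy i k with h | rfl | h
  · have h1 : i.castSucc ≤ k.castSucc := h.le
    have h2 : i.succ ≤ k.castSucc := Fin.succ_le_castSucc_iff.2 h
    simp only [if_pos h1, if_pos h2, sub_self, mul_zero]
  · simp only [le_refl, if_true, if_neg (not_le_of_gt i.castSucc_lt_succ), sub_zero]
    by_cases hq : Q i = 0
    · rw [hβ hq]
      simp
    · rw [pow_succ]
      field_simp
  · have h1 : ¬ i.castSucc ≤ k.castSucc := not_le_of_gt h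
    have h2 : ¬ i.succ ≤ k.castSucc := fun h2 => h1 (i.castSucc_lt_succ.le.trans h2)
    simp only [if_neg h1, if_neg h2, sub_self, mul_zero]

theorem realizable_weight (p : Param Q) : Realizable Q (weight Q p) := by
  have h : weight Q p = (∑ k : Fin n,
      (((p.1 k).1.1.roots.map fun γ : ℂ => fun (j : Fin (n + 1)) (t : ℕ) =>
          if j ≤ k.castSucc then γ ^ t else 0).sum +
        fun j t => if j ≤ k.castSucc then (Q k)⁻¹ ^ t * (p.1 k).2.1 else 0)) +
      fun _ t => p.2 t := by
    funext j t
    have hsum : ∀ (s : Multiset ℂ) (k : Fin n),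
        (s.map fun γ : ℂ => fun (j : Fin (n + 1)) (t : ℕ) =>
          if j ≤ k.castSucc then γ ^ t else 0).sum j t =
        if j ≤ k.castSucc then (s.map fun γ => γ ^ t).sum else 0 := by
      intro s k
      induction s using Multiset.induction_on with
      | empty => simp
      | cons a s ih =>
        rw [Multiset.map_cons, Multiset.sum_cons, Pi.add_apply, Pi.add_apply, ih, Multiset.map_cons,
          Multiset.sum_cons]
        split_ifs <;> simp
    rw [weight, Finset.sum_filter]
    simp only [Pi.add_apply, Finset.sum_apply, hsum]
    congr 1
    refine Finset.sum_congr rfl fun k _ => ?_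
    split_ifs
    · rw [rankOneWeight_eq _ (p.1 k).2.2, powerSum]
    · rw [add_zero]
  rw [h]
  refine Realizable.add (Finset.sum_induction _ (Realizable Q) (fun _ _ => Realizable.add)
    realizable_zero fun k _ => Realizable.add ?_ (realizable_inv k (p.1 k).2.2))
    (realizable_of_character fun i t => by simp)
  refine Multiset.sum_induction (Realizable Q) _ (fun _ _ => Realizable.add) realizable_zero ?_
  intro w hw
  obtain ⟨γ, -, rfl⟩ := Multiset.mem_map.1 hw
  exact realizable_fundamental k γ

end DeformedCurrent

end

open DeformedCurrent
theorem mainTheorem2 {n : ℕ} (Q : Fin n → ℂ) :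
    (∀ p : Param Q,
      IsSimpleModule (U Q) (L Q (weight Q p)) ∧
      IsHighestWeightModule Q (weight Q p) (L Q (weight Q p)) ∧
      FiniteDimensional ℂ (L Q (weight Q p))) ∧
    (∀ p p' : Param Q,
      Nonempty (L Q (weight Q p) ≃ₗ[U Q] L Q (weight Q p')) ↔ p = p') ∧
    (∀ (M : Type*) [AddCommGroup M] [Module ℂ M] [Module (U Q) M] [IsScalarTower ℂ (U Q) M]
      [FiniteDimensional ℂ M] [IsSimpleModule (U Q) M],
      ∃ p : Param Q, Nonempty (M ≃ₗ[U Q] L Q (weight Q p))) := by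
  have hsimple : ∀ p : Param Q, IsSimpleModule (U Q) (L Q (weight Q p)) ∧
      FiniteDimensional ℂ (L Q (weight Q p)) := by
    intro p
    obtain ⟨V, _, _, _, _, _, v, h0, hv⟩ := (realizable_weight p).exists_module
    exact ⟨isSimpleModule_L hv h0, finiteDimensional_L hv h0⟩
  refine ⟨fun p => ⟨(hsimple p).1, isHighestWeightModule_L _, (hsimple p).2⟩, fun p p' => ⟨?_, ?_⟩,
    ?_⟩
  · rintro ⟨e⟩
    have := (hsimple p).1
    have := (hsimple p').1
    have h0 : ∀ p : Param Q, IsSimpleModule (U Q) (L Q (weight Q p)) →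
        (Submodule.Quotient.mk (vermaVector Q (weight Q p)) : L Q (weight Q p)) ≠ 0 := by
      intro p hp h
      have h1 := span_mk_vermaVector (Q := Q) (weight Q p)
      rw [h, Submodule.span_zero_singleton] at h1
      have := IsSimpleModule.nontrivial (U Q) (L Q (weight Q p))
      exact bot_ne_top h1
    have hv := isHighestWeightVector_mk (Q := Q) (weight Q p)
    refine weight_injective ((isHighestWeightVector_mk (Q := Q) (weight Q p')).weight_unique
      (h0 p' inferInstance) (v' := e (Submodule.Quotient.mk (vermaVector Q (weight Q p))))
      ⟨fun i t => ?_, fun j t => ?_⟩ fun h => h0 p inferInstance ?_)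
    · rw [← map_smul, hv.1, map_zero]
    · rw [← map_smul, hv.2, ← algebraMap_smul (U Q) (weight Q p j t), map_smul, algebraMap_smul]
    · exact (map_eq_zero_iff e e.injective).1 h
  · rintro rfl
    exact ⟨LinearEquiv.refl _ _⟩
  · intro M _ _ _ _ _ _
    have := IsSimpleModule.nontrivial (U Q) M
    obtain ⟨w, v, h0, hv⟩ := exists_isHighestWeightVector (Q := Q) (M := M)
    obtain ⟨p, rfl⟩ := exists_weight_eq fun i => hv.exists_rankOneWeight_eq h0 i
    exact ⟨p, nonempty_equiv_L hv h0⟩
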